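/- For real parameters $c=(\mathrm a,\mathrm b)$ let $F=F_c:\mathbb R^2\to\mathbb R^2$ be the map $F(x,y)=(\mathrm a x-y,\,x)$ if $x>0$ or ($x=0$ and $y\le 0$), and $F(x,y)=(\mathrm b x-y,\,x)$ otherwise. The symbolic word of the $F$-orbit of a point has the letter $a$ or $b$ at time $t$ according to which of the two formulae applies to the $t$-th iterate. The rotation number $\theta(c)$ is the limit, as $N\to\infty$, of $\frac1N$ times the number of occurrences of the factor $ab$ in the prefix of length $N$ of the symbolic word; saying that $\theta(c)=\theta$ means that this limit exists and equals $\theta$ for every nonzero initial point. A word $w=w_0\cdots w_{N-1}$ in $a,b$ of length $N\ge 2$ is positive if it starts with $a$ and negative if it starts with $b$; put $z_0=(0,-1)$ if $w$ is positive, $z_0=(0,1)$ if $w$ is negative, and $z_t=F^t(z_0)$. A parameter pair $c$ is legal for $w$ if $z_N$ lies on the line $x=0$ and $w_t$ equals the $t$-th letter of the symbolic word of $z_0$ for every $0\le t<N$ for which $z_t$ does not lie on the line $x=0$. Let $Q_0=0$, $Q_1=1$, $Q_{t+1}=w_tQ_t-Q_{t-1}$, polynomials in $a,b$, let $k=\lfloor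 N/2\rfloor$, and let $C_w=Q_{k+1}-Q_k$ if $N$ is odd, $C_w=Q_{k+1}-Q_{k-1}$ if $N$ is even. For $w$ of odd rank (that is, with first letter equal to last letter) let $\mathcal C_w$ be the legal branch of the critical curve $\{c\in\mathbb R^2: C_w(c)=0\}$, that is, its branch (connected component) that contains legal points for $w$. Let $\zeta_j=2\cos(\pi/j)$, let $\mathcal D_{\kappa,\ell}=[\zeta_\kappa,\zeta_{\kappa+1}]\times[\zeta_\ell,\zeta_{\ell+1}]$, and let $$\vartheta^{\pm}_{j,m}=\frac{m}{mj\pm1}.$$ **Corollary.** Let $\kappa,\ell\ge 2$ and $n,m\ge 0$ be integers. For each of the following two choices of words $w,w'$ and of the number $\vartheta$, 1. $w=(a^{\kappa+1}b^{\ell})^n a^{\kappa}$, $\ w'=(b^{\ell+1}a^{\kappa})^m b^{\ell}$, $\ \vartheta=\vartheta^-_{\kappa+\ell+1,\,n+m+1}$; 2. $w=a^{\kappa+1}(b^{\ell+1}a^{\kappa})^n$, $\ w'=b^{\ell+1}(a^{\kappa+1}b^{\ell})^m$, $\ \vartheta=\vartheta^+_{\kappa+\ell+1,\,n+m+1}$;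 the curves $\mathcal C_w$ and $\mathcal C_{w'}$ intersect within $\mathcal D_{\kappa,\ell}$, and $\theta(c)=\vartheta$ at every point $c\in\mathcal C_w\cap\mathcal C_{w'}$ that lies in $\mathcal D_{\kappa,\ell}$ or is legal for both $w$ and $w'$. -/

import Mathlib

open Filter Topology

namespace CriticalCurves

noncomputable section

/-- The two letters, naming the two half-planes on which the planar map is linear. -/
inductive Letter
  | a
  | b
  deriving DecidableEq

/-- The real parameter attached to a letter at the parameter pair `c = (a, b)`. -/
def Letter.value (c : ℝ × ℝ) : Letter → ℝ
  | .a => c.1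
  | .b => c.2

open Classical in
/-- The letter of the half-plane containing `z`; the closed negative ordinate semi-axis
belongs to the half-plane of `a`, the open positive one to that of `b`. -/
def symbol (z : ℝ × ℝ) : Letter :=
  if 0 < z.1 ∨ (z.1 = 0 ∧ z.2 ≤ 0) then .a else .b

/-- The piecewise linear map `F (x, y) = (a x - y, x)` or `(b x - y, x)`,
according to the half-plane containing `(x, y)`. -/
def F (c z : ℝ × ℝ) : ℝ × ℝ :=
  ((symbol z).value c * z.1 - z.2, z.1)

/-- The symbolic word of the `F`-orbit of `z`. -/
def code (c z : ℝ × ℝ) (t : ℕ) : Letter :=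
  symbol ((F c)^[t] z)

/-- The number of occurrences of the factor `ab` in the prefix of length `n` of the
symbolic word of the orbit of `z`. -/
def abCount (c z : ℝ × ℝ) (n : ℕ) : ℕ :=
  ((Finset.range n).filter fun t =>
    t + 1 < n ∧ code c z t = .a ∧ code c z (t + 1) = .b).card

/-- The rotation number of `F` at the parameter pair `c` exists and equals `θ`: for every
nonzero initial point the frequency of the factor `ab` in the symbolic word tends to `θ`. -/
def HasRotationNumber (c : ℝ × ℝ) (θ : ℝ) : Prop :=
  ∀ z : ℝ × ℝ, z ≠ 0 → Tendsto (fun n : ℕ => (abCount c z n : ℝ) / n) atTop (𝓝 θ)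

/-- Point on the initial boundary ray of a word: `(0, -1)` for a positive word (first letter
`a`), `(0, 1)` for a negative word (first letter `b`). -/
def startPoint : List Letter → ℝ × ℝ
  | .b :: _ => (0, 1)
  | _ => (0, -1)

/-- `c` is a legal point for the word `w = w₀ ⋯ w_{n-1}`: the `F`-orbit of the initial
boundary ray of `w` is on a boundary ray (the ordinate axis) at time `n`, and `w` agrees with
the symbolic word of this orbit segment at all times at which the orbit is not on a boundary
ray. On boundary rays the letter is immaterial, as the two branches of `F` coincide there. -/
def IsLegal (w : List Letter) (c : ℝ × ℝ) : Prop :=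
  ((F c)^[w.length] (startPoint w)).1 = 0 ∧
    ∀ (t : ℕ) (ht : t < w.length),
      ((F c)^[t] (startPoint w)).1 ≠ 0 → w[t] = code c (startPoint w) t

/-- The value at `c` of the signed continuant `Q_t(w₁, …, w_{t-1})`:
`Q₀ = 0`, `Q₁ = 1`, `Q_{t+1} = w_t Q_t - Q_{t-1}`. It is used for `t ≤ w.length` only. -/
def Q (w : List Letter) (c : ℝ × ℝ) : ℕ → ℝ
  | 0 => 0
  | 1 => 1
  | t + 2 => (w.getD (t + 1) .a).value c * Q w c (t + 1) - Q w c t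

/-- The polynomial `C_w` of a word of odd rank and length `n ≥ 2`, evaluated at `c`. With
`k = ⌊n/2⌋` it is `Q_{k+1} - Q_k` for `n` odd and `Q_{k+1} - Q_{k-1}` for `n` even. -/
def C (w : List Letter) (c : ℝ × ℝ) : ℝ :=
  if Odd w.length then Q w c (w.length / 2 + 1) - Q w c (w.length / 2)
  else Q w c (w.length / 2 + 1) - Q w c (w.length / 2 - 1)

/-- The critical curve of a word of odd rank: the zero set of `C_w` in the parameter plane. -/
def curve (w : List Letter) : Set (ℝ × ℝ) :=
  {c | C w c = 0}

/-- The legal branch of the critical curve of `w`: the branch (connected component) containing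
legal points. -/
def legalBranch (w : List Letter) : Set (ℝ × ℝ) :=
  {c | ∃ c₀, IsLegal w c₀ ∧ c ∈ connectedComponentIn (curve w) c₀}

/-- `ζ_j = 2 cos (π / j)`. -/
def zeta (j : ℕ) : ℝ :=
  2 * Real.cos (Real.pi / j)

/-- The rotational domain `D_{κ,ℓ} = [ζ_κ, ζ_{κ+1}] × [ζ_ℓ, ζ_{ℓ+1}]`. -/
def rotDomain (κ ℓ : ℕ) : Set (ℝ × ℝ) :=
  Set.Icc (zeta κ) (zeta (κ + 1)) ×ˢ Set.Icc (zeta ℓ) (zeta (ℓ + 1))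

/-- `θ⁻_{j,m} = m / (m j - 1)`. -/
def thetaMinus (j m : ℕ) : ℝ :=
  (m : ℝ) / ((m : ℝ) * j - 1)

/-- `θ⁺_{j,m} = m / (m j + 1)`. -/
def thetaPlus (j m : ℕ) : ℝ :=
  (m : ℝ) / ((m : ℝ) * j + 1)

/-- The word `a^k`. -/
def aPow (k : ℕ) : List Letter :=
  List.replicate k .a

/-- The word `b^k`. -/
def bPow (k : ℕ) : List Letter :=
  List.replicate k .b

/-- The word `u^n`, the concatenation of `n` copies of `u`. -/
def wordPow (u : List Letter) (n : ℕ) : List Letter :=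
  (List.replicate n u).flatten

/-- The curves of `w` and `w'` meet with rotation number `θ`: their legal branches intersect
within the domain `D`, and the rotation number is `θ` at every intersection point of the legal
branches within `D`, and moreover at every point of the plane, in `D` or not, at which the two
branches meet and which is legal for both words. -/
def MeetWithRotationNumber (D : Set (ℝ × ℝ)) (w w' : List Letter) (θ : ℝ) : Prop :=
  (legalBranch w ∩ legalBranch w' ∩ D).Nonempty ∧
    ∀ c ∈ legalBranch w ∩ legalBranch w',
      (c ∈ D ∨ (IsLegal w c ∧ IsLegal w' c)) → HasRotationNumber c θ

end

end CriticalCurves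

open CriticalCurves

namespace CriticalCurves

/-! Everything takes place on directions, measured in half-turns from `(0, -1)`. Each linear branch
of `F` lifts to a strictly increasing map `step s` of the line that commutes with `u ↦ u + 1`,
decreases as `s` grows, and moves integers (the ordinate axis) by exactly a quarter-turn. Composing
along a word gives the angle `stepWord c w 0`, which is the direction of the pair of consecutive
continuants `(Q_N, Q_{N-1})`.

Legality means that the angle stays in the half-turns prescribed by the letters and ends at an
integer. Every run then uses exactly one half-turn, so the final angle is the number of runs, `2n +
1` or `2m + 1` for the words considered. These words are palindromes once the first letter is
removed; the resulting symmetry of the continuants shows that `C_w = 0` forces the final angle to be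
an integer, and that an odd positive angle forces `C_w = 0`. By continuity the angle is constant
along the legal branch (`stepWord_eq_of_mem_legalBranch`). Conversely, inside the rotational domain
the equation for the angle alone implies legality (`compat_minusWord`, `compat_plusWord`), because
the passage through one block is an increasing map whose orbit is monotone.

The two angle equations have a common solution in the domain: the angles have the right signs on
opposite sides of the rectangle, and a planar intermediate value argument applies
(`exists_common_zero`). At a point legal for both words, the orbit of `(0, -1)` runs through `w` and
then `w'`, making `2n + 1 + 2m + 1` half-turns. This is a periodic direction of the circle map, and
the rotation number is `n + m + 1` full turns divided by the total length. -/

/-! ### Lifted action of the linear maps on directions -/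

/-- The unit vector obtained from `(0, -1)` by `u` counterclockwise half-turns. -/
noncomputable def dir (u : ℝ) : ℝ × ℝ :=
  (Real.sin (Real.pi * u), -Real.cos (Real.pi * u))

/-- The factor by which the shear `(x, y) ↦ (x, y - s x)` multiplies `dir u`,
as a complex number. -/
noncomputable def shearFactor (s u : ℝ) : ℂ :=
  ⟨1 + s * Real.sin (Real.pi * u) * Real.cos (Real.pi * u),
    -(s * Real.sin (Real.pi * u) ^ 2)⟩

/-- The lift to the line of the action of `(x, y) ↦ (s x - y, x)` on directions; the unit is
the half-turn. -/
noncomputable def step (s u : ℝ) : ℝ :=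
  u + 1 / 2 + (shearFactor s u).arg / Real.pi

/-- A shear preserving abscissas and fixing the ordinate axis cannot reverse a vector. Hence the
principal argument is a continuous choice of the angle. -/
theorem shearFactor_mem_slitPlane (s u : ℝ) : shearFactor s u ∈ Complex.slitPlane := by
  rw [Complex.mem_slitPlane_iff]
  by_cases h : s * Real.sin (Real.pi * u) = 0
  · left
    simp [shearFactor, h]
  · right
    have h' := mul_ne_zero_iff.1 h
    simp [shearFactor, h'.1, h'.2]

theorem continuous_step : Continuous fun p : ℝ × ℝ => step p.1 p.2 := by
  have h : Continuous fun p : ℝ × ℝ => shearFactor p.1 p.2 := by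
    have : (fun p : ℝ × ℝ => shearFactor p.1 p.2) = fun p : ℝ × ℝ =>
        ((1 + p.1 * Real.sin (Real.pi * p.2) * Real.cos (Real.pi * p.2) : ℝ) : ℂ)
          + ((-(p.1 * Real.sin (Real.pi * p.2) ^ 2) : ℝ) : ℂ) * Complex.I := by
      funext p
      rw [shearFactor, Complex.mk_eq_add_mul_I]
    rw [this]
    fun_prop
  have h2 : Continuous fun p : ℝ × ℝ => (shearFactor p.1 p.2).arg :=
    continuous_iff_continuousAt.2 fun p =>
      (Complex.continuousAt_arg (shearFactor_mem_slitPlane _ _)).comp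
        (f := fun p : ℝ × ℝ => shearFactor p.1 p.2) h.continuousAt
  unfold step
  fun_prop

theorem shearFactor_add_one (s u : ℝ) : shearFactor s (u + 1) = shearFactor s u := by
  simp [shearFactor, mul_add, Real.sin_add_pi, Real.cos_add_pi]

theorem step_add_one (s u : ℝ) : step s (u + 1) = step s u + 1 := by
  simp only [step, shearFactor_add_one]; ring

theorem step_add_nat (s u : ℝ) (k : ℕ) : step s (u + k) = step s u + k := by
  induction k with
  | zero => simp
  | succ k ih => push_cast; rw [← add_assoc, step_add_one, ih]; ring

theorem step_of_sin_eq_zero {s u : ℝ} (h : Real.sin (Real.pi * u) = 0) :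
    step s u = u + 1 / 2 := by
  have : shearFactor s u = 1 := by apply Complex.ext <;> simp [shearFactor, h]
  simp [step, this]

theorem sin_pi_mul_int (k : ℤ) : Real.sin (Real.pi * k) = 0 := by
  rw [mul_comm, Real.sin_int_mul_pi]

theorem step_int (s : ℝ) (k : ℤ) : step s k = k + 1 / 2 :=
  step_of_sin_eq_zero (sin_pi_mul_int k)

theorem step_zero (s : ℝ) : step s 0 = 1 / 2 := by
  simpa using step_int s 0

theorem step_one (s : ℝ) : step s 1 = 3 / 2 := by
  have := step_int s 1
  norm_num at this ⊢
  exact this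

/-- The linear map is the shear followed by a counterclockwise quarter-turn, the `1 / 2` in `step`;
the scale `r` is the norm of `shearFactor`. -/
theorem exists_dir_step (s u : ℝ) : ∃ r : ℝ, 0 < r ∧
    s * (dir u).1 - (dir u).2 = r * (dir (step s u)).1 ∧
    (dir u).1 = r * (dir (step s u)).2 := by
  have hz : shearFactor s u ≠ 0 := Complex.slitPlane_ne_zero (shearFactor_mem_slitPlane s u)
  have hr : 0 < ‖shearFactor s u‖ := norm_pos_iff.2 hz
  refine ⟨‖shearFactor s u‖, hr, ?_⟩
  have e : Real.pi * step s u
      = Real.pi * u + (shearFactor s u).arg + Real.pi / 2 := by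
    unfold step; field_simp; ring
  have hc : ‖shearFactor s u‖ * Real.cos (shearFactor s u).arg
      = 1 + s * Real.sin (Real.pi * u) * Real.cos (Real.pi * u) := by
    rw [Complex.norm_mul_cos_arg]; rfl
  have hs : ‖shearFactor s u‖ * Real.sin (shearFactor s u).arg
      = -(s * Real.sin (Real.pi * u) ^ 2) := by
    rw [Complex.norm_mul_sin_arg]; rfl
  have p := Real.sin_sq_add_cos_sq (Real.pi * u)
  simp only [dir, e, Real.sin_add, Real.cos_add, Real.sin_pi_div_two, Real.cos_pi_div_two]
  constructor
  · linear_combination (-Real.cos (Real.pi * u)) * hc + Real.sin (Real.pi * u) * hs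
      - s * Real.sin (Real.pi * u) * p
  · linear_combination (-Real.sin (Real.pi * u)) * hc - Real.cos (Real.pi * u) * hs

/-- Two angles with positively proportional directions differ by a multiple of two. -/
theorem exists_eq_add_two_mul {u v r : ℝ} (hr : 0 < r) (h₁ : (dir u).1 = r * (dir v).1)
    (h₂ : (dir u).2 = r * (dir v).2) : ∃ k : ℤ, u = v + 2 * k := by
  simp only [dir] at h₁ h₂
  have pu := Real.sin_sq_add_cos_sq (Real.pi * u)
  have pv := Real.sin_sq_add_cos_sq (Real.pi * v)
  have h₃ : Real.cos (Real.pi * u) = r * Real.cos (Real.pi * v) := by linarith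
  have r1 : r = 1 := by
    rw [h₁, h₃] at pu
    have : r ^ 2 = 1 := by linear_combination pu - r ^ 2 * pv
    nlinarith
  subst r1
  have hc : Real.cos (Real.pi * u - Real.pi * v) = 1 := by
    rw [Real.cos_sub, h₁, h₃]; linarith
  obtain ⟨k, hk⟩ := (Real.cos_eq_one_iff _).1 hc
  refine ⟨k, ?_⟩
  have := Real.pi_pos
  have : Real.pi * (u - v - 2 * k) = 0 := by linear_combination -hk
  rcases mul_eq_zero.1 this with h | h
  · linarith
  · linarith

theorem step_add_two_mul_int (s u : ℝ) (k : ℤ) : step s (u + 2 * k) = step s u + 2 * k := by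
  have h : ∀ (u : ℝ) (k : ℕ), step s (u + 2 * k) = step s u + 2 * k := fun u k => by
    have := step_add_nat s u (2 * k)
    push_cast at this
    exact this
  obtain ⟨j, rfl | rfl⟩ := k.eq_nat_or_neg
  · exact_mod_cast h u j
  · have := h (u + 2 * ((-(j : ℤ) : ℤ) : ℝ)) j
    push_cast at this ⊢
    rw [add_assoc, show (2 * -(j : ℝ) + 2 * j) = 0 by ring, add_zero] at this
    linarith

theorem step_injective (s : ℝ) : Function.Injective (step s) := by
  intro u v h
  obtain ⟨r, hr, h₁, h₂⟩ := exists_dir_step s u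
  obtain ⟨r', hr', h₁', h₂'⟩ := exists_dir_step s v
  rw [h] at h₁ h₂
  have e₁ : (dir u).1 = r / r' * (dir v).1 := by rw [h₂, h₂']; field_simp
  have e₂ : (dir u).2 = r / r' * (dir v).2 := by
    have a₁ : (dir u).2 = s * (dir u).1 - r * (dir (step s v)).1 := by linarith
    have a₂ : (dir v).2 = s * (dir v).1 - r' * (dir (step s v)).1 := by linarith
    rw [a₁, a₂, e₁]; field_simp
  obtain ⟨k, rfl⟩ := exists_eq_add_two_mul (div_pos hr hr') e₁ e₂
  rw [step_add_two_mul_int] at h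
  linarith

/-- Injectivity comes from invertibility of the linear map; commuting with `u ↦ u + 1` excludes the
decreasing case. -/
theorem step_strictMono (s : ℝ) : StrictMono (step s) := by
  have hc : Continuous (step s) := continuous_step.comp (by fun_prop : Continuous fun u => (s, u))
  rcases hc.strictMono_of_inj (step_injective s) with h | h
  · exact h
  · have := h (show (0 : ℝ) < 0 + 1 by norm_num)
    rw [step_add_one] at this
    linarith

theorem step_strictAnti_left {u : ℝ} (hu : Real.sin (Real.pi * u) ≠ 0) :
    StrictAnti fun s => step s u := by
  have hc : Continuous fun s => step s u :=
    continuous_step.comp (by fun_prop : Continuous fun s => (s, u))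
  have hi : Function.Injective fun s => step s u := by
    intro s t h
    dsimp only at h
    obtain ⟨r, hr, h₁, h₂⟩ := exists_dir_step s u
    obtain ⟨r', hr', h₁', h₂'⟩ := exists_dir_step t u
    rw [h] at h₁ h₂
    have hd : (dir u).1 ≠ 0 := hu
    have h0 : (dir (step t u)).2 ≠ 0 := fun h0 => hd (by rw [h₂, h0, mul_zero])
    have e : r = r' := mul_right_cancel₀ h0 (h₂.symm.trans h₂')
    subst e
    exact mul_right_cancel₀ hd (by linarith)
  -- The sense of monotonicity is decided by comparing `s = 0`, where the shear is trivial, with `s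
  -- = 1`, where it turns clockwise.
  rcases hc.strictMono_of_inj hi with h | h
  · have h1 := h (show (0 : ℝ) < 1 by norm_num)
    have e0 : (shearFactor 0 u) = 1 := by apply Complex.ext <;> simp [shearFactor]
    have e1 : (shearFactor 1 u).arg < 0 := by
      rw [Complex.arg_neg_iff]
      have := pow_pos (abs_pos.2 hu) 2
      rw [sq_abs] at this
      simpa [shearFactor] using this
    simp only [step, e0, Complex.arg_one, zero_div] at h1
    have := div_neg_of_neg_of_pos e1 Real.pi_pos
    linarith
  · exact h

theorem step_le_step {s t u v : ℝ} (hst : s ≤ t) (huv : v ≤ u) : step t v ≤ step s u := by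
  refine le_trans ?_ ((step_strictMono s).monotone huv)
  by_cases h : Real.sin (Real.pi * v) = 0
  · rw [step_of_sin_eq_zero h, step_of_sin_eq_zero h]
  · exact (step_strictAnti_left h).antitone hst

/-! ### Angles and continuants along a word -/

/-- The composition of the lifts `step` along a word. -/
noncomputable def stepWord (c : ℝ × ℝ) (w : List Letter) (u : ℝ) : ℝ :=
  w.foldl (fun v l => step (l.value c) v) u

@[simp] theorem stepWord_nil (c : ℝ × ℝ) (u : ℝ) : stepWord c [] u = u := rfl

@[simp] theorem stepWord_cons (c : ℝ × ℝ) (l : Letter) (w : List Letter) (u : ℝ) :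
    stepWord c (l :: w) u = stepWord c w (step (l.value c) u) := rfl

theorem stepWord_append (c : ℝ × ℝ) (v w : List Letter) (u : ℝ) :
    stepWord c (v ++ w) u = stepWord c w (stepWord c v u) := by
  simp [stepWord]

theorem stepWord_replicate (c : ℝ × ℝ) (l : Letter) (p : ℕ) (u : ℝ) :
    stepWord c (List.replicate p l) u = (step (l.value c))^[p] u := by
  induction p generalizing u with
  | zero => rfl
  | succ p ih => rw [List.replicate_succ, stepWord_cons, ih, Function.iterate_succ_apply]

theorem stepWord_strictMono (c : ℝ × ℝ) (w : List Letter) : StrictMono (stepWord c w) := by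
  induction w with
  | nil => exact strictMono_id
  | cons l w ih => exact ih.comp (step_strictMono _)

theorem stepWord_add_one (c : ℝ × ℝ) (w : List Letter) (u : ℝ) :
    stepWord c w (u + 1) = stepWord c w u + 1 := by
  induction w generalizing u with
  | nil => rfl
  | cons l w ih => simp only [stepWord_cons, step_add_one, ih]

theorem continuous_value (l : Letter) : Continuous fun c : ℝ × ℝ => l.value c := by
  cases l <;> simp only [Letter.value] <;> fun_prop

theorem continuous_stepWord (w : List Letter) (u : ℝ) :
    Continuous fun c : ℝ × ℝ => stepWord c w u := by
  suffices ∀ f : ℝ × ℝ → ℝ, Continuous f → Continuous fun c => stepWord c w (f c) from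
    this _ continuous_const
  induction w with
  | nil => exact fun f hf => hf
  | cons l w ih =>
    exact fun f hf => ih _ (continuous_step.comp ((continuous_value l).prodMk hf))

theorem stepWord_le_stepWord {c d : ℝ × ℝ} (h : ∀ l : Letter, l.value c ≤ l.value d)
    (w : List Letter) {u v : ℝ} (huv : v ≤ u) : stepWord d w v ≤ stepWord c w u := by
  induction w generalizing u v with
  | nil => exact huv
  | cons l w ih => exact ih (step_le_step (h l) huv)

/-- The recurrence for `Q` is the linear map applied to the vector `(Q_{t+1}, Q_t)`. The first
letter sends `(0, -1)` to `(1, 0)` whatever its parameter, which is why the continuants do not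
involve it. -/
theorem exists_Q_eq (w : List Letter) (c : ℝ × ℝ) (t : ℕ) (ht : t < w.length) :
    ∃ r : ℝ, 0 < r ∧ Q w c (t + 1) = r * (dir (stepWord c (w.take (t + 1)) 0)).1 ∧
      Q w c t = r * (dir (stepWord c (w.take (t + 1)) 0)).2 := by
  induction t with
  | zero =>
    refine ⟨1, one_pos, ?_⟩
    rw [← List.take_append_getElem ht]
    simp [step_zero, Q, dir, ← div_eq_mul_inv]
  | succ t ih =>
    obtain ⟨r, hr, h₁, h₂⟩ := ih (by omega)
    rw [← List.take_append_getElem ht, stepWord_append]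
    obtain ⟨r', hr', h₁', h₂'⟩ :=
      exists_dir_step (w[t + 1].value c) (stepWord c (w.take (t + 1)) 0)
    refine ⟨r * r', mul_pos hr hr', ?_, ?_⟩
    · rw [stepWord_cons, stepWord_nil, Q, List.getD_eq_getElem _ _ ht, h₁, h₂]
      linear_combination r * h₁'
    · rw [stepWord_cons, stepWord_nil, h₁]
      linear_combination r * h₂'

/-! ### The lift of `F`, and legality in terms of angles -/

/-- The sign of the abscissa in the half-plane of a letter. -/
def sgn : Letter → ℝ
  | .a => 1
  | .b => -1

open Classical in
/-- The letter of the half-plane containing the vector `dir u`. -/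
noncomputable def sideLetter (u : ℝ) : Letter :=
  if Even ⌊u⌋ then .a else .b

/-- The lift of the map `F` to the line. -/
noncomputable def liftF (c : ℝ × ℝ) (u : ℝ) : ℝ :=
  step ((sideLetter u).value c) u

theorem exists_eq_two_mul_add (u : ℝ) : ∃ (k : ℤ) (f : ℝ), 0 ≤ f ∧ f < 1 ∧
    ((u = 2 * k + f ∧ sideLetter u = .a) ∨ (u = 2 * k + f + 1 ∧ sideLetter u = .b)) := by
  have hu := Int.floor_add_fract u
  rcases Int.even_or_odd ⌊u⌋ with h | h
  · obtain ⟨k, hk⟩ := h.two_dvd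
    refine ⟨k, Int.fract u, Int.fract_nonneg u, Int.fract_lt_one u, Or.inl ⟨?_, if_pos h⟩⟩
    rw [hk] at hu; push_cast at hu; exact hu.symm
  · obtain ⟨k, hk⟩ := h
    refine ⟨k, Int.fract u, Int.fract_nonneg u, Int.fract_lt_one u,
      Or.inr ⟨?_, if_neg (by simp [hk])⟩⟩
    rw [hk] at hu; push_cast at hu; linarith

theorem sin_pi_mul_add (k : ℤ) (f : ℝ) :
    Real.sin (Real.pi * (2 * k + f)) = Real.sin (Real.pi * f) := by
  rw [show Real.pi * (2 * k + f) = Real.pi * f + k * (2 * Real.pi) by ring,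
    Real.sin_add_int_mul_two_pi]

theorem cos_pi_mul_add (k : ℤ) (f : ℝ) :
    Real.cos (Real.pi * (2 * k + f)) = Real.cos (Real.pi * f) := by
  rw [show Real.pi * (2 * k + f) = Real.pi * f + k * (2 * Real.pi) by ring,
    Real.cos_add_int_mul_two_pi]

theorem sin_pi_mul_add_one (u : ℝ) :
    Real.sin (Real.pi * (u + 1)) = -Real.sin (Real.pi * u) := by
  rw [mul_add, mul_one, Real.sin_add_pi]

theorem cos_pi_mul_add_one (u : ℝ) :
    Real.cos (Real.pi * (u + 1)) = -Real.cos (Real.pi * u) := by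
  rw [mul_add, mul_one, Real.cos_add_pi]

theorem sin_pi_mul_pos {f : ℝ} (h₀ : 0 < f) (h₁ : f < 1) : 0 < Real.sin (Real.pi * f) := by
  have := Real.pi_pos
  exact Real.sin_pos_of_pos_of_lt_pi (by positivity) (by nlinarith)

theorem sin_pi_mul_nonneg {f : ℝ} (h₀ : 0 ≤ f) (h₁ : f ≤ 1) : 0 ≤ Real.sin (Real.pi * f) := by
  have := Real.pi_pos
  exact Real.sin_nonneg_of_nonneg_of_le_pi (by positivity) (by nlinarith)

theorem symbol_smul_dir {r : ℝ} (hr : 0 < r) (u : ℝ) : symbol (r • dir u) = sideLetter u := by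
  obtain ⟨k, f, h₀, h₁, ⟨rfl, h⟩ | ⟨rfl, h⟩⟩ := exists_eq_two_mul_add u
  · rw [h, symbol, if_pos]
    simp only [dir, Prod.smul_mk, smul_eq_mul, sin_pi_mul_add, cos_pi_mul_add]
    rcases h₀.eq_or_lt with rfl | h₀
    · simp [hr.le]
    · exact Or.inl (mul_pos hr (sin_pi_mul_pos h₀ h₁))
  · rw [h, symbol, if_neg]
    simp only [dir, Prod.smul_mk, smul_eq_mul, sin_pi_mul_add, cos_pi_mul_add,
      sin_pi_mul_add_one, cos_pi_mul_add_one]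
    rcases h₀.eq_or_lt with rfl | h₀
    · simp [hr]
    · have := mul_pos hr (sin_pi_mul_pos h₀ h₁)
      rintro (h | h) <;> linarith

theorem exists_F_smul_dir (c : ℝ × ℝ) {r : ℝ} (hr : 0 < r) (u : ℝ) :
    ∃ r' : ℝ, 0 < r' ∧ F c (r • dir u) = r' • dir (liftF c u) := by
  obtain ⟨r', hr', h₁, h₂⟩ := exists_dir_step ((sideLetter u).value c) u
  refine ⟨r * r', mul_pos hr hr', ?_⟩
  rw [F, symbol_smul_dir hr]
  apply Prod.ext
  · simp only [Prod.smul_fst, Prod.smul_snd, smul_eq_mul]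
    rw [liftF]
    linear_combination r * h₁
  · simp only [Prod.smul_fst, Prod.smul_snd, smul_eq_mul]
    rw [liftF]
    linear_combination r * h₂

theorem exists_iterate_F (c : ℝ × ℝ) {r : ℝ} (hr : 0 < r) (u : ℝ) (t : ℕ) :
    ∃ r' : ℝ, 0 < r' ∧ (F c)^[t] (r • dir u) = r' • dir ((liftF c)^[t] u) := by
  induction t with
  | zero => exact ⟨r, hr, rfl⟩
  | succ t ih =>
    obtain ⟨r', hr', h⟩ := ih
    rw [Function.iterate_succ_apply', h, Function.iterate_succ_apply']
    exact exists_F_smul_dir c hr' _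

theorem code_smul_dir (c : ℝ × ℝ) {r : ℝ} (hr : 0 < r) (u : ℝ) (t : ℕ) :
    code c (r • dir u) t = sideLetter ((liftF c)^[t] u) := by
  obtain ⟨r', hr', h⟩ := exists_iterate_F c hr u t
  rw [code, h, symbol_smul_dir hr']

theorem sgn_sideLetter_mul_nonneg (u : ℝ) :
    0 ≤ sgn (sideLetter u) * Real.sin (Real.pi * u) := by
  obtain ⟨k, f, h₀, h₁, ⟨rfl, h⟩ | ⟨rfl, h⟩⟩ := exists_eq_two_mul_add u <;> rw [h] <;>
    simpa [sgn, sin_pi_mul_add, sin_pi_mul_add_one] using sin_pi_mul_nonneg h₀ h₁.le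

theorem eq_sideLetter {l : Letter} {u : ℝ} (h : 0 ≤ sgn l * Real.sin (Real.pi * u))
    (h₀ : Real.sin (Real.pi * u) ≠ 0) : l = sideLetter u := by
  have h₁ := sgn_sideLetter_mul_nonneg u
  generalize sideLetter u = l' at *
  have : Real.sin (Real.pi * u) = 0 ∨ l = l' := by
    cases l <;> cases l' <;> simp only [sgn] at * <;> simp <;> linarith
  exact this.resolve_left h₀

/-- The abscissas of the linear orbit along a word have the signs prescribed by `ε`. -/
def Compat (ε : Letter → ℝ) (c : ℝ × ℝ) : List Letter → ℝ → Prop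
  | [], _ => True
  | l :: w, u => 0 ≤ ε l * Real.sin (Real.pi * u) ∧ Compat ε c w (step (l.value c) u)

theorem compat_append (ε : Letter → ℝ) (c : ℝ × ℝ) (v w : List Letter) (u : ℝ) :
    Compat ε c (v ++ w) u ↔ Compat ε c v u ∧ Compat ε c w (stepWord c v u) := by
  induction v generalizing u with
  | nil => simp [Compat]
  | cons l v ih => simp [Compat, ih, and_assoc]

theorem compat_add_one (ε : Letter → ℝ) (c : ℝ × ℝ) (w : List Letter) (u : ℝ) :
    Compat ε c w (u + 1) ↔ Compat (-ε) c w u := by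
  induction w generalizing u with
  | nil => rfl
  | cons l w ih => simp [Compat, ih, sin_pi_mul_add_one, step_add_one]

theorem compat_add_two_mul (ε : Letter → ℝ) (c : ℝ × ℝ) (w : List Letter) (u : ℝ) (k : ℕ) :
    Compat ε c w (u + 2 * k) ↔ Compat ε c w u := by
  induction k with
  | zero => simp
  | succ k ih =>
    rw [show u + 2 * ((k + 1 : ℕ) : ℝ) = u + 2 * k + 1 + 1 by push_cast; ring, compat_add_one,
      compat_add_one, neg_neg, ih]

/-- A weak inequality suffices because the two branches agree on the ordinate axis. -/
theorem step_eq_liftF {l : Letter} {c : ℝ × ℝ} {u : ℝ}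
    (h : 0 ≤ sgn l * Real.sin (Real.pi * u)) : step (l.value c) u = liftF c u := by
  by_cases h₀ : Real.sin (Real.pi * u) = 0
  · rw [liftF, step_of_sin_eq_zero h₀, step_of_sin_eq_zero h₀]
  · rw [liftF, ← eq_sideLetter h h₀]

theorem Compat.stepWord_eq {c : ℝ × ℝ} {w : List Letter} {u : ℝ} (h : Compat sgn c w u) :
    stepWord c w u = (liftF c)^[w.length] u := by
  induction w generalizing u with
  | nil => rfl
  | cons l w ih =>
    rw [stepWord_cons, ih h.2, List.length_cons, Function.iterate_succ_apply,
      step_eq_liftF h.1]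

theorem compat_iff (c : ℝ × ℝ) (w : List Letter) (u : ℝ) :
    Compat sgn c w u ↔ ∀ (t : ℕ) (ht : t < w.length),
      0 ≤ sgn w[t] * Real.sin (Real.pi * (liftF c)^[t] u) := by
  induction w generalizing u with
  | nil => simp [Compat]
  | cons l w ih =>
    constructor
    · rintro ⟨h₁, h₂⟩ t ht
      cases t with
      | zero => exact h₁
      | succ t =>
        rw [step_eq_liftF h₁, ih] at h₂
        exact h₂ t (by simpa using ht)
    · intro h
      have h₁ : 0 ≤ sgn l * Real.sin (Real.pi * u) := h 0 (by simp)
      refine ⟨h₁, ?_⟩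
      rw [step_eq_liftF h₁, ih]
      exact fun t ht => h (t + 1) (by simpa using ht)

/-- The number of half-turns from `(0, -1)` to the start point of a word. -/
def startAngle : List Letter → ℝ
  | .b :: _ => 1
  | _ => 0

theorem startPoint_eq (w : List Letter) : startPoint w = (1 : ℝ) • dir (startAngle w) := by
  rcases w with _ | ⟨_ | _, w⟩ <;> simp [startPoint, startAngle, dir]

theorem isLegal_iff (w : List Letter) (c : ℝ × ℝ) : IsLegal w c ↔
    Compat sgn c w (startAngle w) ∧ Real.sin (Real.pi * stepWord c w (startAngle w)) = 0 := by
  have key : ∀ t, ((F c)^[t] (startPoint w)).1 = 0 ↔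
      Real.sin (Real.pi * (liftF c)^[t] (startAngle w)) = 0 := by
    intro t
    obtain ⟨r, hr, h⟩ := exists_iterate_F c one_pos (startAngle w) t
    rw [startPoint_eq, h]
    simp [dir, hr.ne']
  have hcode : ∀ t, code c (startPoint w) t = sideLetter ((liftF c)^[t] (startAngle w)) := by
    intro t
    rw [startPoint_eq, code_smul_dir c one_pos]
  simp only [IsLegal, key, hcode, Ne]
  constructor
  · rintro ⟨h₁, h₂⟩
    have hc : Compat sgn c w (startAngle w) := by
      rw [compat_iff]
      intro t ht
      by_cases h₀ : Real.sin (Real.pi * (liftF c)^[t] (startAngle w)) = 0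
      · rw [h₀, mul_zero]
      · rw [h₂ t ht h₀]; exact sgn_sideLetter_mul_nonneg _
    exact ⟨hc, by rwa [hc.stepWord_eq]⟩
  · rintro ⟨hc, h₁⟩
    refine ⟨by rwa [← hc.stepWord_eq], fun t ht h₀ => ?_⟩
    exact eq_sideLetter ((compat_iff c w _).1 hc t ht) h₀

/-- Central symmetry adds one to the angle and flips the signs, so that negative words can be
started from angle `0` as well. -/
theorem isLegal_cons_iff (l : Letter) (w : List Letter) (c : ℝ × ℝ) : IsLegal (l :: w) c ↔
    Compat (sgn l • sgn) c (l :: w) 0 ∧ Real.sin (Real.pi * stepWord c (l :: w) 0) = 0 := by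
  rw [isLegal_iff]
  cases l
  · simp [startAngle, sgn]
  · have : startAngle (.b :: w) = 0 + 1 := by simp [startAngle]
    rw [this, compat_add_one, stepWord_add_one, sin_pi_mul_add_one, neg_eq_zero]
    simp [sgn]

/-! ### Each run takes one half-turn -/

/-- The number of letter changes in the word `l :: w`. -/
def turns (l : Letter) : List Letter → ℕ
  | [] => 0
  | x :: w => (if x = l then 0 else 1) + turns x w

theorem sin_pi_mul_sub_nat (v : ℝ) (k : ℕ) :
    (-1) ^ k * Real.sin (Real.pi * v) = Real.sin (Real.pi * (v - k)) := by
  rw [mul_sub, mul_comm Real.pi (k : ℝ), Real.sin_sub_nat_mul_pi]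

theorem le_one_of_sin_nonneg {v : ℝ} (h₁ : v ≤ 3 / 2)
    (h : 0 ≤ Real.sin (Real.pi * v)) : v ≤ 1 := by
  by_contra! hv
  have := sin_pi_mul_pos (f := v - 1) (by linarith) (by linarith)
  have e := sin_pi_mul_add_one (v - 1)
  rw [sub_add_cancel] at e
  linarith

theorem one_le_of_sin_nonpos {v : ℝ} (h₀ : 1 / 2 ≤ v)
    (h : Real.sin (Real.pi * v) ≤ 0) : 1 ≤ v := by
  by_contra! hv
  have := sin_pi_mul_pos (f := v) (by linarith) (by linarith)
  linarith

/-- Integers move by a quarter-turn, so one step takes `[k, k + 1]` into `[k + 1/2, k + 3/2]`. The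
sign demanded by the next letter tells on which side of `k + 1` the angle lies: the same letter
keeps the half-turn, the other one opens the next. -/
theorem stepWord_mem_Icc {ε : Letter → ℝ} (hε : ε .a = -ε .b) (c : ℝ × ℝ) (w : List Letter)
    (l : Letter) (k : ℕ) (u : ℝ) (hl : ε l = (-1) ^ k) (h₀ : k ≤ u) (h₁ : u ≤ k + 1)
    (hw : Compat ε c w (step (l.value c) u)) :
    stepWord c (l :: w) u ∈ Set.Icc (k + turns l w + 1 / 2 : ℝ) (k + turns l w + 3 / 2) := by
  have hk : ∀ s, step s k = k + 1 / 2 := fun s => by exact_mod_cast step_int s k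
  have g₀ := (step_strictMono (l.value c)).monotone h₀
  have g₁ := (step_strictMono (l.value c)).monotone h₁
  rw [step_add_one] at g₁
  rw [hk] at g₀ g₁
  induction w generalizing l k u with
  | nil => simp only [turns, stepWord_cons, stepWord_nil, Nat.cast_zero]
           constructor <;> linarith
  | cons x w ih =>
    obtain ⟨hx, hw⟩ := hw
    rw [stepWord_cons]
    generalize step (l.value c) u = v at *
    by_cases hxl : x = l
    · subst hxl
      rw [hl, sin_pi_mul_sub_nat] at hx
      have := le_one_of_sin_nonneg (by linarith) hx
      have h₁' : v ≤ k + 1 := by linarith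
      have m₀ := (step_strictMono (x.value c)).monotone (show (k : ℝ) ≤ v by linarith)
      have m₁ := (step_strictMono (x.value c)).monotone h₁'
      rw [step_add_one] at m₁
      rw [hk] at m₀ m₁
      have := ih x k v hl (by linarith) h₁' hw hk m₀ m₁
      simpa [turns] using this
    · have hx' : ε x = (-1) ^ (k + 1) := by
        rw [pow_succ, ← hl]
        cases x <;> cases l <;> simp_all
      rw [hx', pow_succ, mul_neg_one, neg_mul, sin_pi_mul_sub_nat] at hx
      have := one_le_of_sin_nonpos (v := v - k) (by linarith) (by linarith)
      have h₀' : ((k + 1 : ℕ) : ℝ) ≤ v := by push_cast; linarith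
      have h₁' : v ≤ (k + 1 : ℕ) + 1 := by push_cast; linarith
      have m₀ := (step_strictMono (x.value c)).monotone h₀'
      have m₁ := (step_strictMono (x.value c)).monotone h₁'
      have hk' : ∀ s, step s ((k + 1 : ℕ) : ℝ) = (k + 1 : ℕ) + 1 / 2 :=
        fun s => by exact_mod_cast step_int s (k + 1 : ℕ)
      rw [step_add_one] at m₁
      rw [hk'] at m₀ m₁
      have := ih x (k + 1) v hx' h₀' h₁' hw hk' m₀ m₁
      simp only [turns, hxl, if_false]
      push_cast at this ⊢
      constructor <;> linarith [this.1, this.2]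

/-- For a legal point, the orbit of the initial ray makes as many half-turns as the word has
runs. -/
theorem IsLegal.stepWord_eq {l : Letter} {w : List Letter} {c : ℝ × ℝ}
    (h : IsLegal (l :: w) c) : stepWord c (l :: w) 0 = turns l w + 1 := by
  rw [isLegal_cons_iff] at h
  have := stepWord_mem_Icc (ε := sgn l • sgn) (by simp [sgn]) c w l 0 0
    (by cases l <;> simp [sgn]) (by simp) (by simp) h.1.2
  generalize stepWord c (l :: w) 0 = v at *
  simp only [Nat.cast_zero, zero_add] at this
  have hs : Real.sin (Real.pi * (v - turns l w)) = 0 := by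
    rw [← sin_pi_mul_sub_nat, h.2, mul_zero]
  have h₁ := le_one_of_sin_nonneg (by linarith [this.2]) hs.ge
  have h₂ := one_le_of_sin_nonpos (by linarith [this.1]) hs.le
  linarith

/-! ### Palindromic words and the critical polynomial -/

theorem eq_zero_of_recurrence {d v : ℕ → ℝ} {N j : ℕ}
    (h : ∀ t, t + 2 ≤ N → d (t + 2) = v (t + 1) * d (t + 1) - d t) (hj : j + 1 ≤ N)
    (h₀ : d j = 0) (h₁ : d (j + 1) = 0) {t : ℕ} (ht : t ≤ N) : d t = 0 := by
  have down : ∀ i, i ≤ j → d i = 0 ∧ d (i + 1) = 0 := fun i hi => by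
    induction hi using Nat.decreasingInduction with
    | self => exact ⟨h₀, h₁⟩
    | of_succ i hi ih =>
      have := h i (by omega)
      rw [show i + 2 = i + 1 + 1 from rfl, ih.1, ih.2] at this
      exact ⟨by linarith, ih.1⟩
  have up : ∀ i, j ≤ i → i + 1 ≤ N → d i = 0 ∧ d (i + 1) = 0 := fun i hi => by
    induction i, hi using Nat.le_induction with
    | base => exact fun _ => ⟨h₀, h₁⟩
    | succ i hi ih =>
      intro hN
      have := h i (by omega)
      rw [(ih (by omega)).1, (ih (by omega)).2] at this
      exact ⟨(ih (by omega)).2, by rw [this]; simp⟩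
  rcases le_total t j with htj | htj
  · exact (down t htj).1
  · rcases htj.eq_or_lt with rfl | htj
    · exact h₀
    · obtain ⟨s, rfl⟩ : ∃ s, t = s + 1 := ⟨t - 1, by omega⟩
      exact (up s (by omega) ht).2

theorem getD_symm {w : List Letter} {x : Letter} (h : (w ++ [x]).reverse = w ++ [x]) {t : ℕ}
    (h₁ : 1 ≤ t) (h₂ : t < w.length) : w.getD t .a = w.getD (w.length - t) .a := by
  have e : (w ++ [x])[t]? = (w ++ [x])[w.length - t]? := by
    conv_lhs => rw [← h]
    rw [List.getElem?_reverse (by simp; omega)]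
    congr 1
    simp
  rw [List.getElem?_append_left h₂, List.getElem?_append_left (by omega)] at e
  rw [List.getD_eq_getElem?_getD, List.getD_eq_getElem?_getD, e]

/-- The palindrome makes `t ↦ Q_{N-t}` obey the same linear recurrence as `Q`, hence so does
`Q_{N-t} - μ Q_t`. -/
theorem Q_reverse_sub {w : List Letter} {x : Letter} (h : (w ++ [x]).reverse = w ++ [x])
    (c : ℝ × ℝ) (μ : ℝ) (t : ℕ) (ht : t + 2 ≤ w.length) :
    Q w c (w.length - (t + 2)) - μ * Q w c (t + 2) =
      (w.getD (t + 1) .a).value c * (Q w c (w.length - (t + 1)) - μ * Q w c (t + 1))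
        - (Q w c (w.length - t) - μ * Q w c t) := by
  obtain ⟨s, hs⟩ : ∃ s, w.length = t + 2 + s := ⟨w.length - (t + 2), by omega⟩
  have e := getD_symm h (t := t + 1) (by omega) (by omega)
  rw [show w.length - (t + 1) = s + 1 by omega] at e
  rw [show w.length - (t + 2) = s by omega, show w.length - (t + 1) = s + 1 by omega,
    show w.length - t = s + 2 by omega, Q, Q, ← e]
  ring

/-- `C_w = 0` says that `Q_{N-t} - Q_t` vanishes at two consecutive indices in the middle, hence
everywhere; at `t = 0` this is the claim. -/
theorem Q_length_eq_zero {w : List Letter} {x : Letter} (h : (w ++ [x]).reverse = w ++ [x])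
    (hw : 2 ≤ w.length) {c : ℝ × ℝ} (hc : C w c = 0) : Q w c w.length = 0 := by
  have key : ∃ j, j + 1 ≤ w.length ∧ Q w c (w.length - j) - 1 * Q w c j = 0 ∧
      Q w c (w.length - (j + 1)) - 1 * Q w c (j + 1) = 0 := by
    unfold C at hc
    split_ifs at hc with hodd
    · obtain ⟨k, hk⟩ := hodd
      rw [show w.length / 2 = k by omega] at hc
      refine ⟨k, by omega, ?_, ?_⟩
      · rw [show w.length - k = k + 1 by omega]; linarith
      · rw [show w.length - (k + 1) = k by omega]; linarith
    · obtain ⟨k, hk⟩ := (Nat.not_odd_iff_even.1 hodd).two_dvd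
      obtain ⟨i, rfl⟩ : ∃ i, k = i + 1 := ⟨k - 1, by omega⟩
      rw [show w.length / 2 = i + 1 by omega] at hc
      refine ⟨i, by omega, ?_, ?_⟩
      · rw [show w.length - i = i + 1 + 1 by omega]; simp at hc; linarith
      -- For even length the central index is its own mirror image, so this term vanishes for free.
      · rw [show w.length - (i + 1) = i + 1 by omega]; ring
  obtain ⟨j, hj, h₀, h₁⟩ := key
  have := eq_zero_of_recurrence (d := fun t => Q w c (w.length - t) - 1 * Q w c t)
    (v := fun t => (w.getD t .a).value c) (Q_reverse_sub h c 1) hj h₀ h₁ (Nat.zero_le _)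
  simpa [Q] using this

/-- With `μ = Q_{N-1}`, the sequence `Q_{N-t} - μ Q_t` vanishes at `t = 0, 1`, hence everywhere.
Evaluating at `t = N - 1` gives `μ² = 1`; the sign hypothesis selects `μ = 1`, the case that `C_w`
detects. -/
theorem C_eq_zero {w : List Letter} {x : Letter} (h : (w ++ [x]).reverse = w ++ [x])
    (hw : 2 ≤ w.length) {c : ℝ × ℝ} (h₀ : Q w c w.length = 0)
    (h₁ : 0 ≤ Q w c (w.length - 1)) : C w c = 0 := by
  have key : ∀ t ≤ w.length, Q w c (w.length - t) - Q w c (w.length - 1) * Q w c t = 0 :=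
    fun t ht => eq_zero_of_recurrence
      (d := fun t => Q w c (w.length - t) - Q w c (w.length - 1) * Q w c t)
      (v := fun t => (w.getD t .a).value c) (Q_reverse_sub h c _) (j := 0) (by omega)
      (by simp [h₀, Q]) (by simp [Q]) ht
  have hone : Q w c (w.length - 1) = 1 := by
    have := key (w.length - 1) (by omega)
    rw [show w.length - (w.length - 1) = 1 by omega, Q] at this
    nlinarith
  rw [hone] at key
  unfold C
  split_ifs with hodd
  · obtain ⟨k, hk⟩ := hodd
    have := key k (by omega)
    rw [show w.length - k = k + 1 by omega] at this
    rw [show w.length / 2 = k by omega]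
    linarith
  · obtain ⟨k, hk⟩ := (Nat.not_odd_iff_even.1 hodd).two_dvd
    have := key (k - 1) (by omega)
    rw [show w.length - (k - 1) = k + 1 by omega] at this
    rw [show w.length / 2 = k by omega]
    linarith

theorem sin_stepWord_eq_zero {w : List Letter} {x : Letter}
    (h : (w ++ [x]).reverse = w ++ [x]) (hw : 2 ≤ w.length) {c : ℝ × ℝ} (hc : C w c = 0) :
    Real.sin (Real.pi * stepWord c w 0) = 0 := by
  obtain ⟨r, hr, h₁, -⟩ := exists_Q_eq w c (w.length - 1) (by omega)
  rw [show w.length - 1 + 1 = w.length by omega, List.take_length,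
    Q_length_eq_zero h hw hc] at h₁
  exact (mul_eq_zero.1 h₁.symm).resolve_left hr.ne'

theorem C_eq_zero_of_stepWord_eq {w : List Letter} {x : Letter}
    (h : (w ++ [x]).reverse = w ++ [x]) (hw : 2 ≤ w.length) {c : ℝ × ℝ} {n : ℕ}
    (hc : stepWord c w 0 = 2 * n + 1) : C w c = 0 := by
  obtain ⟨r, hr, h₁, h₂⟩ := exists_Q_eq w c (w.length - 1) (by omega)
  rw [show w.length - 1 + 1 = w.length by omega, List.take_length, hc, dir] at h₁ h₂
  have hs := sin_pi_mul_add n 1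
  have hcos := cos_pi_mul_add n 1
  push_cast at hs hcos
  rw [hs] at h₁
  rw [hcos] at h₂
  refine C_eq_zero h hw (by rw [h₁]; simp) ?_
  rw [h₂]
  simpa using hr.le

/-! ### Constancy of the angle along the legal branch -/

theorem isDiscrete_range_intCast : IsDiscrete (Set.range ((↑) : ℤ → ℝ)) :=
  Int.isClosedEmbedding_coe_real.isEmbedding.isInducing.isDiscrete_range

/-- Along the legal branch, the number of half-turns made by the initial ray is constant. -/
theorem stepWord_eq_of_mem_legalBranch {l x : Letter} {w : List Letter}
    (h : (l :: w ++ [x]).reverse = l :: w ++ [x]) (hw : 2 ≤ (l :: w).length) {c : ℝ × ℝ}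
    (hc : c ∈ legalBranch (l :: w)) : stepWord c (l :: w) 0 = turns l w + 1 := by
  obtain ⟨c₀, hl, hc⟩ := hc
  rw [← hl.stepWord_eq]
  have hmem : c₀ ∈ curve (l :: w) := by
    by_contra hn
    rw [connectedComponentIn_eq_empty hn] at hc
    exact hc
  -- On the critical curve the final angle is an integer, and a continuous integer-valued function
  -- is constant on a connected set.
  refine isPreconnected_connectedComponentIn.constant_of_mapsTo
    (T := Set.range ((↑) : ℤ → ℝ)) isDiscrete_range_intCast (continuous_stepWord _ _).continuousOn (fun d hd => ?_)
    hc (mem_connectedComponentIn hmem)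
  have hd' : C (l :: w) d = 0 := (connectedComponentIn_subset _ _ hd : d ∈ curve (l :: w))
  obtain ⟨k, hk⟩ := Real.sin_eq_zero_iff.1 (sin_stepWord_eq_zero h hw hd')
  refine ⟨k, ?_⟩
  have := Real.pi_pos
  have : Real.pi * ((k : ℝ) - stepWord d (l :: w) 0) = 0 := by linear_combination hk
  rcases mul_eq_zero.1 this with h | h <;> linarith

/-! ### Combinatorics of the two families of words -/

theorem wordPow_succ (u : List Letter) (n : ℕ) : wordPow u (n + 1) = u ++ wordPow u n := by
  simp [wordPow, List.replicate_succ]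

theorem wordPow_append_self (u v : List Letter) (n : ℕ) :
    wordPow (u ++ v) n ++ u = u ++ wordPow (v ++ u) n := by
  induction n with
  | zero => simp [wordPow]
  | succ n ih => simp [wordPow_succ, ih]

theorem reverse_wordPow (u : List Letter) (n : ℕ) :
    (wordPow u n).reverse = wordPow u.reverse n := by
  simp [wordPow, List.reverse_flatten]

theorem reverse_append_wordPow {u v : List Letter} (hu : u.reverse = u) (hv : v.reverse = v)
    (n : ℕ) : (u ++ wordPow (v ++ u) n).reverse = u ++ wordPow (v ++ u) n := by
  rw [List.reverse_append, reverse_wordPow, List.reverse_append, hu, hv, wordPow_append_self]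

/-- The word `(l^{p+1} l'^q)^n l^p`. -/
def minusWord (l l' : Letter) (p q n : ℕ) : List Letter :=
  wordPow (List.replicate (p + 1) l ++ List.replicate q l') n ++ List.replicate p l

/-- The word `l^{p+1} (l'^{q+1} l^p)^n`. -/
def plusWord (l l' : Letter) (p q n : ℕ) : List Letter :=
  List.replicate (p + 1) l ++ wordPow (List.replicate (q + 1) l' ++ List.replicate p l) n

/-- Since the word begins with `l`, this expresses that the word without its first letter is a
palindrome. -/
theorem reverse_minusWord (l l' : Letter) (p q n : ℕ) :
    (minusWord l l' p q n ++ [l]).reverse = minusWord l l' p q n ++ [l] := by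
  have : minusWord l l' p q n ++ [l] = List.replicate (p + 1) l ++
      wordPow (List.replicate q l' ++ List.replicate (p + 1) l) n := by
    rw [← wordPow_append_self, minusWord, List.append_assoc, ← List.replicate_succ']
  rw [this, reverse_append_wordPow (by simp) (by simp)]

theorem plusWord_eq (l l' : Letter) (p q n : ℕ) :
    plusWord l l' p q n = l :: (wordPow (List.replicate p l ++ List.replicate (q + 1) l') n ++
      List.replicate p l) := by
  rw [wordPow_append_self, plusWord, List.replicate_succ (n := p)]
  rfl

theorem reverse_plusWord (l l' : Letter) (p q n : ℕ) :
    (plusWord l l' p q n ++ [l]).reverse = plusWord l l' p q n ++ [l] := by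
  rw [plusWord_eq, wordPow_append_self, List.cons_append, List.reverse_cons,
    List.reverse_append, reverse_append_wordPow (by simp) (by simp)]
  simp

theorem turns_replicate_self (l : Letter) (p : ℕ) (w : List Letter) :
    turns l (List.replicate p l ++ w) = turns l w := by
  induction p with
  | zero => rfl
  | succ p ih => simpa [List.replicate_succ, turns] using ih

theorem turns_replicate_of_ne {l l' : Letter} (h : l ≠ l') {p : ℕ} (hp : 1 ≤ p)
    (w : List Letter) : turns l' (List.replicate p l ++ w) = 1 + turns l w := by
  obtain ⟨p, rfl⟩ : ∃ i, p = i + 1 := ⟨p - 1, by omega⟩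
  simp [List.replicate_succ, turns, h, turns_replicate_self]

theorem turns_minusWord {l l' : Letter} (h : l ≠ l') {p q : ℕ} (hp : 1 ≤ p) (hq : 1 ≤ q)
    (n : ℕ) : turns l (minusWord l l' p q n) = 2 * n := by
  suffices turns l (minusWord l l' p q n) = 2 * n ∧
      turns l' (minusWord l l' p q n) = 2 * n + 1 from this.1
  induction n with
  | zero =>
    have h₁ := turns_replicate_self l p []
    have h₂ := turns_replicate_of_ne h hp []
    simp only [List.append_nil, turns] at h₁ h₂
    simp [minusWord, wordPow, h₁, h₂]
  | succ n ih =>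
    have e : minusWord l l' p q (n + 1) = List.replicate (p + 1) l ++
        (List.replicate q l' ++ minusWord l l' p q n) := by
      simp [minusWord, wordPow_succ]
    rw [e, turns_replicate_self, turns_replicate_of_ne h (by omega),
      turns_replicate_of_ne h.symm hq, ih.2]
    omega

theorem turns_plusWord {l l' : Letter} (h : l ≠ l') {p : ℕ} (hp : 1 ≤ p) (q n : ℕ) :
    turns l (plusWord l l' p q n) = 2 * n := by
  rw [plusWord, turns_replicate_self]
  induction n with
  | zero => rfl
  | succ n ih =>
    rw [wordPow_succ, List.append_assoc,
      turns_replicate_of_ne h.symm (by omega), turns_replicate_of_ne h hp, ih]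
    omega

theorem length_wordPow (u : List Letter) (n : ℕ) : (wordPow u n).length = n * u.length := by
  simp [wordPow]

theorem length_minusWord (l l' : Letter) (p q n : ℕ) :
    (minusWord l l' p q n).length = n * (p + 1 + q) + p := by
  simp [minusWord, length_wordPow]

theorem length_plusWord (l l' : Letter) (p q n : ℕ) :
    (plusWord l l' p q n).length = p + 1 + n * (q + 1 + p) := by
  simp [plusWord, length_wordPow]

/-! ### Single runs and the thresholds `ζ_j` -/

theorem iterate_step_strictMono (s : ℝ) (p : ℕ) : StrictMono (step s)^[p] :=
  (step_strictMono s).iterate p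

theorem iterate_step_add_one (s : ℝ) (p : ℕ) (u : ℝ) :
    (step s)^[p] (u + 1) = (step s)^[p] u + 1 := by
  have h : Function.Commute (step s) (fun v => v + 1) := fun v => step_add_one s v
  exact (h.iterate_left p) u

theorem iterate_step_nonneg (s : ℝ) (p : ℕ) {u : ℝ} (hu : 0 ≤ u) : 0 ≤ (step s)^[p] u := by
  induction p with
  | zero => exact hu
  | succ p ih =>
    have := (step_strictMono s).monotone ih
    rw [step_zero] at this
    rw [Function.iterate_succ_apply']
    linarith

theorem one_lt_iterate_step (s : ℝ) (p : ℕ) {u : ℝ} (hu : 1 < u) : 1 < (step s)^[p] u := by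
  induction p with
  | zero => exact hu
  | succ p ih =>
    have := step_strictMono s ih
    rw [step_one] at this
    rw [Function.iterate_succ_apply']
    linarith

/-- An angle that has passed `1` never comes back, so only the last one needs to be checked. -/
theorem iterate_step_mem_Icc {s u : ℝ} {p j : ℕ} (h₀ : 0 ≤ u) (h₁ : (step s)^[p] u ≤ 1)
    (hj : j ≤ p) : (step s)^[j] u ∈ Set.Icc (0 : ℝ) 1 := by
  refine ⟨iterate_step_nonneg s j h₀, ?_⟩
  by_contra! h
  have := one_lt_iterate_step s (p - j) h
  rw [← Function.iterate_add_apply, show p - j + j = p by omega] at this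
  linarith

/-- Entering a run at angle `1 / 2` amounts to entering it at `0` one letter earlier. -/
theorem iterate_step_half (s : ℝ) (p : ℕ) : (step s)^[p] (1 / 2) = (step s)^[p + 1] 0 := by
  rw [Function.iterate_succ_apply, step_zero]

/-- For `s = 2 cos α` with `α = π / j`, the orbit of `(0, -sin α)` is `(sin tα, sin (t - 1)α)`. Its
abscissa is nonnegative up to time `j` and vanishes there, so exactly one half-turn has been made.
-/
theorem iterate_step_zeta {j : ℕ} (hj : 2 ≤ j) : (step (zeta j))^[j] 0 = 1 := by
  have hj' : (2 : ℝ) ≤ j := by exact_mod_cast hj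
  set α := Real.pi / j with hα
  have hjα : j * α = Real.pi := by rw [hα]; field_simp
  have hα₀ : 0 < α := div_pos Real.pi_pos (by linarith)
  have hα₁ : α < Real.pi := by nlinarith
  have key : ∀ t ≤ j, (step (zeta j))^[t] 0 ∈ Set.Icc (0 : ℝ) 1 ∧ ∃ r : ℝ, 0 < r ∧
      Real.sin (t * α) = r * (dir ((step (zeta j))^[t] 0)).1 ∧
      Real.sin ((t - 1) * α) = r * (dir ((step (zeta j))^[t] 0)).2 := by
    intro t ht
    induction t with
    | zero =>
      refine ⟨by simp, Real.sin α, Real.sin_pos_of_pos_of_lt_pi hα₀ hα₁, ?_⟩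
      simp [dir]
    | succ t ih =>
      obtain ⟨hm, r, hr, h₁, h₂⟩ := ih (by omega)
      rw [Function.iterate_succ_apply']
      generalize (step (zeta j))^[t] 0 = u at *
      obtain ⟨r', hr', h₁', h₂'⟩ := exists_dir_step (zeta j) u
      have hrr := mul_pos hr hr'
      have e : Real.sin ((t + 1 : ℕ) * α) = r * r' * (dir (step (zeta j) u)).1 := by
        have : Real.sin ((t + 1 : ℕ) * α)
            = zeta j * Real.sin (t * α) - Real.sin ((t - 1) * α) := by
          push_cast
          rw [zeta, ← hα, add_mul, sub_mul, one_mul, Real.sin_add, Real.sin_sub]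
          ring
        rw [this, h₁, h₂]
        linear_combination r * h₁'
      refine ⟨⟨?_, ?_⟩, r * r', hrr, e, ?_⟩
      · have := (step_strictMono (zeta j)).monotone hm.1
        rw [step_zero] at this
        linarith
      · have hu := (step_strictMono (zeta j)).monotone hm.2
        rw [step_one] at hu
        refine le_one_of_sin_nonneg hu ?_
        have hs : 0 ≤ Real.sin ((t + 1 : ℕ) * α) := by
          refine Real.sin_nonneg_of_nonneg_of_le_pi (by positivity) ?_
          rw [← hjα]
          exact mul_le_mul_of_nonneg_right (by exact_mod_cast ht) hα₀.le
        rw [e] at hs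
        exact nonneg_of_mul_nonneg_right hs hrr
      · push_cast
        rw [add_sub_cancel_right, h₁, h₂']
        ring
  obtain ⟨hm, r, hr, h, -⟩ := key j le_rfl
  rw [hjα, Real.sin_pi] at h
  have hs := (mul_eq_zero.1 h.symm).resolve_left hr.ne'
  refine le_antisymm hm.2 (one_le_of_sin_nonpos ?_ hs.le)
  obtain ⟨i, rfl⟩ : ∃ i, j = i + 1 := ⟨j - 1, by omega⟩
  rw [Function.iterate_succ_apply', ← step_zero (zeta (i + 1))]
  exact (step_strictMono _).monotone (key i (by omega)).1.1

theorem iterate_step_anti {s t : ℝ} (h : s ≤ t) (p : ℕ) (u : ℝ) :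
    (step t)^[p] u ≤ (step s)^[p] u :=
  (step_strictMono t).monotone.iterate_le_of_le (fun _ => step_le_step h le_rfl) p u

theorem iterate_step_le_one {j : ℕ} (hj : 2 ≤ j) {s : ℝ} (h : zeta j ≤ s) :
    (step s)^[j] 0 ≤ 1 :=
  (iterate_step_anti h j 0).trans_eq (iterate_step_zeta hj)

theorem one_le_iterate_step {j : ℕ} (hj : 2 ≤ j) {s : ℝ} (h : s ≤ zeta j) :
    1 ≤ (step s)^[j] 0 :=
  (iterate_step_zeta hj).symm.trans_le (iterate_step_anti h j 0)

theorem compat_replicate {ε : Letter → ℝ} {c : ℝ × ℝ} {l : Letter} {p : ℕ} {u : ℝ}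
    (hl : ε l = 1) (h : ∀ j < p, (step (l.value c))^[j] u ∈ Set.Icc (0 : ℝ) 1) :
    Compat ε c (List.replicate p l) u := by
  induction p generalizing u with
  | zero => trivial
  | succ p ih =>
    have h₀ := h 0 (by omega)
    refine ⟨?_, ih fun j hj => ?_⟩
    · rw [hl, one_mul]
      exact sin_pi_mul_nonneg h₀.1 h₀.2
    · simpa using h (j + 1) (by omega)

/-! ### Block maps: legality inside the domain and signs on its sides -/

/-- One passage through a block, diminished by a full turn. -/
noncomputable def blockMap (c : ℝ × ℝ) (w : List Letter) (u : ℝ) : ℝ :=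
  stepWord c w u - 2

theorem blockMap_strictMono (c : ℝ × ℝ) (w : List Letter) : StrictMono (blockMap c w) :=
  fun _ _ h => sub_lt_sub_right (stepWord_strictMono c w h) 2

theorem stepWord_add_two_mul (c : ℝ × ℝ) (w : List Letter) (u : ℝ) (k : ℕ) :
    stepWord c w (u + 2 * k) = stepWord c w u + 2 * k := by
  induction k with
  | zero => simp
  | succ k ih =>
    rw [show u + 2 * ((k + 1 : ℕ) : ℝ) = u + 2 * k + 1 + 1 by push_cast; ring,
      stepWord_add_one, stepWord_add_one, ih]
    push_cast; ring

theorem stepWord_wordPow (c : ℝ × ℝ) (w : List Letter) (n : ℕ) (u : ℝ) :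
    stepWord c (wordPow w n) u = (blockMap c w)^[n] u + 2 * n := by
  induction n generalizing u with
  | zero => simp [wordPow]
  | succ n ih =>
    rw [wordPow_succ, stepWord_append,
      show stepWord c w u = blockMap c w u + 2 * (1 : ℕ) by simp [blockMap],
      stepWord_add_two_mul, ih, Function.iterate_succ_apply]
    push_cast; ring

theorem compat_wordPow {ε : Letter → ℝ} {c : ℝ × ℝ} {w : List Letter} {n : ℕ} {u : ℝ}
    (h : ∀ j < n, Compat ε c w ((blockMap c w)^[j] u)) : Compat ε c (wordPow w n) u := by
  induction n generalizing u with
  | zero => trivial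
  | succ n ih =>
    rw [wordPow_succ, compat_append,
      show stepWord c w u = blockMap c w u + 2 * (1 : ℕ) by simp [blockMap],
      compat_add_two_mul]
    exact ⟨h 0 (by omega), ih fun j hj => by simpa using h (j + 1) (by omega)⟩

section Blocks

variable {c : ℝ × ℝ} {l l' : Letter} {p q : ℕ}

theorem stepWord_minusWord (n : ℕ) :
    stepWord c (minusWord l l' p q n) 0 = (step (l.value c))^[p]
      ((blockMap c (List.replicate (p + 1) l ++ List.replicate q l'))^[n] 0) + 2 * n := by
  rw [minusWord, stepWord_append, stepWord_wordPow, stepWord_add_two_mul, stepWord_replicate]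

theorem stepWord_plusWord (n : ℕ) :
    stepWord c (plusWord l l' p q n) 0 = (step (l.value c))^[p]
      ((blockMap c (List.replicate p l ++ List.replicate (q + 1) l'))^[n] (1 / 2)) + 2 * n := by
  rw [plusWord_eq, stepWord_cons, step_zero, stepWord_append, stepWord_wordPow,
    stepWord_add_two_mul, stepWord_replicate]

theorem blockMap_apply (i j : ℕ) (u : ℝ) :
    blockMap c (List.replicate i l ++ List.replicate j l') u =
      (step (l'.value c))^[j] ((step (l.value c))^[i] u) - 2 := by
  rw [blockMap, stepWord_append, stepWord_replicate, stepWord_replicate]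

/-- If the block map sent `0` below `0`, its iterates would stay below and the final angle would be
too small. Hence the orbit of `0` increases, and the bound known for the last run holds for all
earlier ones. -/
theorem compat_minusWord {ε : Letter → ℝ} (hl : ε l = 1) (hl' : ε l' = -1) (hq : 1 ≤ q)
    (hA : (step (l.value c))^[p] 0 ≤ 1) (hA' : 1 ≤ (step (l.value c))^[p + 1] 0)
    (hB : (step (l'.value c))^[q] 0 ≤ 1) {n : ℕ}
    (h : stepWord c (minusWord l l' p q n) 0 = 2 * n + 1) :
    Compat ε c (minusWord l l' p q n) 0 := by
  have hblock : ∀ v, 0 ≤ v → (step (l.value c))^[p] v ≤ 1 →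
      Compat ε c (List.replicate (p + 1) l ++ List.replicate q l') v := by
    intro v h₀ h₁
    rw [compat_append]
    refine ⟨compat_replicate hl fun j hj => iterate_step_mem_Icc h₀ h₁ (by omega), ?_⟩
    rw [stepWord_replicate]
    obtain ⟨y, hy⟩ : ∃ y, (step (l.value c))^[p + 1] v = y + 1 := ⟨_, (sub_add_cancel _ 1).symm⟩
    have y₀ := (iterate_step_strictMono (l.value c) (p + 1)).monotone h₀
    have y₁ := (step_strictMono (l.value c)).monotone h₁
    rw [← Function.iterate_succ_apply' (step (l.value c)), step_one] at y₁
    rw [hy] at y₀ y₁ ⊢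
    rw [compat_add_one]
    -- The second run starts at `y` in `[0, 1/2]`, no later than a run from `0` with one letter
    -- spent.
    refine compat_replicate (by simp [hl']) fun j hj =>
      iterate_step_mem_Icc (p := q - 1) (by linarith) ?_ (by omega)
    refine ((iterate_step_strictMono _ (q - 1)).monotone (show y ≤ 1 / 2 by linarith)).trans ?_
    rw [iterate_step_half, show q - 1 + 1 = q by omega]
    exact hB
  rw [stepWord_minusWord] at h
  have hlast : ∀ v, 0 ≤ v → (step (l.value c))^[p] v ≤ 1 →
      Compat ε c (List.replicate p l) v := fun v h₀ h₁ =>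
    compat_replicate hl fun j hj => iterate_step_mem_Icc h₀ h₁ hj.le
  set M := blockMap c (List.replicate (p + 1) l ++ List.replicate q l') with hM
  have hmono : StrictMono M := blockMap_strictMono _ _
  have hseq : ∀ j ≤ n, 0 ≤ M^[j] 0 ∧ M^[j] 0 ≤ M^[n] 0 := by
    rcases n.eq_zero_or_pos with rfl | hn
    · intro j hj
      obtain rfl : j = 0 := by omega
      simp
    have hM0 : 0 ≤ M 0 := by
      by_contra! hneg
      have h₁ : M^[n] 0 < 0 := hmono.strictAnti_iterate_of_map_lt hneg hn
      have h₂ := iterate_step_strictMono (l.value c) p h₁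
      linarith
    have hm := hmono.monotone.monotone_iterate_of_le_map hM0
    exact fun j hj => ⟨hm (Nat.zero_le j), hm hj⟩
  have hbound : ∀ j ≤ n, (step (l.value c))^[p] (M^[j] 0) ≤ 1 := fun j hj => by
    have := (iterate_step_strictMono (l.value c) p).monotone (hseq j hj).2
    linarith
  rw [minusWord, compat_append, stepWord_wordPow, compat_add_two_mul, ← hM]
  exact ⟨compat_wordPow fun j hj => hblock _ (hseq j hj.le).1 (hbound j hj.le),
    hlast _ (hseq n le_rfl).1 (hbound n le_rfl)⟩

/-- Mirror image of the other family: after the first letter the blocks start at `1 / 2`, a block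
map raising it would make the final angle too large, so the orbit of `1 / 2` decreases. -/
theorem compat_plusWord {ε : Letter → ℝ} (hl : ε l = 1) (hl' : ε l' = -1) (hp : 1 ≤ p)
    (hA : (step (l.value c))^[p] 0 ≤ 1) (hA' : 1 ≤ (step (l.value c))^[p + 1] 0) {n : ℕ}
    (h : stepWord c (plusWord l l' p q n) 0 = 2 * n + 1) :
    Compat ε c (plusWord l l' p q n) 0 := by
  rw [stepWord_plusWord] at h
  have hrun : ∀ v, 0 ≤ v → v ≤ 1 / 2 → Compat ε c (List.replicate p l) v := by
    intro v h₀ h₁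
    refine compat_replicate hl fun j hj =>
      iterate_step_mem_Icc (p := p - 1) h₀ ?_ (by omega)
    refine ((iterate_step_strictMono _ (p - 1)).monotone h₁).trans ?_
    rw [iterate_step_half, show p - 1 + 1 = p by omega]
    exact hA
  have hpos : ∀ v, 1 ≤ (step (l.value c))^[p] v → 0 ≤ v := by
    intro v hv
    by_contra! hneg
    have := iterate_step_strictMono (l.value c) p hneg
    linarith
  set M := blockMap c (List.replicate p l ++ List.replicate (q + 1) l') with hM
  have hblock : ∀ v, 1 ≤ (step (l.value c))^[p] v → v ≤ 1 / 2 → M v ≤ 1 / 2 →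
      Compat ε c (List.replicate p l ++ List.replicate (q + 1) l') v := by
    intro v h₀ h₁ hMv
    rw [compat_append, stepWord_replicate]
    refine ⟨hrun v (hpos v h₀) h₁, ?_⟩
    rw [hM, blockMap_apply] at hMv
    obtain ⟨y, hy⟩ : ∃ y, (step (l.value c))^[p] v = y + 1 := ⟨_, (sub_add_cancel _ 1).symm⟩
    rw [hy] at h₀ hMv ⊢
    rw [compat_add_one]
    refine compat_replicate (by simp [hl']) fun j hj =>
      iterate_step_mem_Icc (p := q) (by linarith) ?_ (by omega)
    rw [iterate_step_add_one, Function.iterate_succ_apply'] at hMv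
    rw [← (step_strictMono (l'.value c)).le_iff_le, step_one]
    linarith
  have hmono : StrictMono M := blockMap_strictMono _ _
  have hseq : ∀ j ≤ n, M^[j] (1 / 2) ≤ 1 / 2 ∧ M^[n] (1 / 2) ≤ M^[j] (1 / 2) := by
    rcases n.eq_zero_or_pos with rfl | hn
    · intro j hj
      obtain rfl : j = 0 := by omega
      simp
    have hM0 : M (1 / 2) ≤ 1 / 2 := by
      by_contra! hneg
      have h₁ : 1 / 2 < M^[n] (1 / 2) := hmono.strictMono_iterate_of_lt_map hneg hn
      have h₂ := iterate_step_strictMono (l.value c) p h₁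
      rw [iterate_step_half] at h₂
      linarith
    have hm := hmono.monotone.antitone_iterate_of_map_le hM0
    exact fun j hj => ⟨hm (Nat.zero_le j), hm hj⟩
  have hbound : ∀ j ≤ n, 1 ≤ (step (l.value c))^[p] (M^[j] (1 / 2)) := fun j hj => by
    have := (iterate_step_strictMono (l.value c) p).monotone (hseq j hj).2
    linarith
  rw [plusWord_eq]
  refine ⟨by simp, ?_⟩
  rw [step_zero, compat_append, stepWord_wordPow, compat_add_two_mul, ← hM]
  refine ⟨compat_wordPow fun j hj => hblock _ (hbound j hj.le) (hseq j hj.le).1 ?_,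
    hrun _ (hpos _ (hbound n le_rfl)) (hseq n le_rfl).1⟩
  rw [← hM, ← Function.iterate_succ_apply' M]
  exact (hseq (j + 1) hj).1

/-- On this side the first `p` letters already complete a half-turn, so the block map does not lower
`0`. The three companion estimates follow the same pattern, the plus family with `1 / 2` in place of
`0`. -/
theorem le_stepWord_minusWord (hA : (step (l.value c))^[p] 0 = 1)
    (hB : 1 ≤ (step (l'.value c))^[q + 1] 0) (n : ℕ) :
    2 * n + 1 ≤ stepWord c (minusWord l l' p q n) 0 := by
  rw [stepWord_minusWord]
  set M := blockMap c (List.replicate (p + 1) l ++ List.replicate q l') with hM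
  have hM0 : 0 ≤ M 0 := by
    rw [hM, blockMap_apply, Function.iterate_succ_apply', hA, step_one,
      show (3 / 2 : ℝ) = 1 / 2 + 1 by norm_num, iterate_step_add_one, iterate_step_half]
    linarith
  have hn : 0 ≤ M^[n] 0 :=
    (blockMap_strictMono _ _).monotone.monotone_iterate_of_le_map hM0 (Nat.zero_le n)
  have := (iterate_step_strictMono (l.value c) p).monotone hn
  linarith

theorem stepWord_minusWord_le (hA : (step (l.value c))^[p] 0 ≤ 1)
    (hA' : (step (l.value c))^[p + 1] 0 = 1) (hB : (step (l'.value c))^[q] 0 ≤ 1) (n : ℕ) :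
    stepWord c (minusWord l l' p q n) 0 ≤ 2 * n + 1 := by
  rw [stepWord_minusWord]
  set M := blockMap c (List.replicate (p + 1) l ++ List.replicate q l') with hM
  have hM0 : M 0 ≤ 0 := by
    rw [hM, blockMap_apply, hA', show (1 : ℝ) = 0 + 1 by norm_num, iterate_step_add_one]
    linarith
  have hn : M^[n] 0 ≤ 0 :=
    (blockMap_strictMono _ _).monotone.antitone_iterate_of_map_le hM0 (Nat.zero_le n)
  have := (iterate_step_strictMono (l.value c) p).monotone hn
  linarith

theorem le_stepWord_plusWord (hA : (step (l.value c))^[p] 0 = 1)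
    (hB : 1 ≤ (step (l'.value c))^[q + 1] 0) (n : ℕ) :
    2 * n + 1 ≤ stepWord c (plusWord l l' p q n) 0 := by
  rw [stepWord_plusWord]
  set M := blockMap c (List.replicate p l ++ List.replicate (q + 1) l') with hM
  have hA' : (step (l.value c))^[p] (1 / 2) = 1 / 2 + 1 := by
    rw [iterate_step_half, Function.iterate_succ_apply', hA, step_one]; norm_num
  have hM0 : 1 / 2 ≤ M (1 / 2) := by
    rw [hM, blockMap_apply, hA', iterate_step_add_one, iterate_step_half,
      Function.iterate_succ_apply']
    have := (step_strictMono (l'.value c)).monotone hB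
    rw [step_one] at this
    linarith
  have hn : 1 / 2 ≤ M^[n] (1 / 2) :=
    (blockMap_strictMono _ _).monotone.monotone_iterate_of_le_map hM0 (Nat.zero_le n)
  have := (iterate_step_strictMono (l.value c) p).monotone hn
  linarith

theorem stepWord_plusWord_le (hA' : (step (l.value c))^[p + 1] 0 = 1)
    (hB : (step (l'.value c))^[q] 0 ≤ 1) (n : ℕ) :
    stepWord c (plusWord l l' p q n) 0 ≤ 2 * n + 1 := by
  rw [stepWord_plusWord]
  set M := blockMap c (List.replicate p l ++ List.replicate (q + 1) l') with hM
  have hM0 : M (1 / 2) ≤ 1 / 2 := by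
    rw [hM, blockMap_apply, iterate_step_half, hA', Function.iterate_succ_apply',
      show (1 : ℝ) = 0 + 1 by norm_num, iterate_step_add_one, step_add_one]
    have := (step_strictMono (l'.value c)).monotone hB
    rw [step_one] at this
    linarith
  have hn : M^[n] (1 / 2) ≤ 1 / 2 :=
    (blockMap_strictMono _ _).monotone.antitone_iterate_of_map_le hM0 (Nat.zero_le n)
  have := (iterate_step_strictMono (l.value c) p).monotone hn
  rw [iterate_step_half] at this
  linarith

end Blocks

/-! ### Intersection in the parameter plane -/

/-- The first letter always leads to angle `1 / 2`, off the axis, so a doubled initial letter makes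
the dependence on its parameter strict. -/
theorem stepWord_lt_stepWord {c d : ℝ × ℝ} (h : ∀ l : Letter, l.value c ≤ l.value d)
    {l : Letter} (hl : l.value c < l.value d) (w : List Letter) :
    stepWord d (l :: l :: w) 0 < stepWord c (l :: l :: w) 0 := by
  simp only [stepWord_cons, step_zero]
  refine (stepWord_strictMono d w (step_strictAnti_left ?_ hl)).trans_le
    (stepWord_le_stepWord h w le_rfl)
  exact (sin_pi_mul_pos (by norm_num) (by norm_num)).ne'

/-- A planar intermediate value theorem: of two functions with opposite signs on opposite sides
of a rectangle, one strictly decreasing in the first variable, there is a common zero. -/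
theorem exists_common_zero {f g : ℝ × ℝ → ℝ} (hf : Continuous f) (hg : Continuous g)
    {a₀ a₁ b₀ b₁ : ℝ} (ha : a₀ ≤ a₁) (hb : b₀ ≤ b₁) (hanti : ∀ y, StrictAnti fun x => f (x, y))
    (hf₀ : ∀ y ∈ Set.Icc b₀ b₁, 0 ≤ f (a₀, y)) (hf₁ : ∀ y ∈ Set.Icc b₀ b₁, f (a₁, y) ≤ 0)
    (hg₀ : ∀ x ∈ Set.Icc a₀ a₁, 0 ≤ g (x, b₀)) (hg₁ : ∀ x ∈ Set.Icc a₀ a₁, g (x, b₁) ≤ 0) :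
    ∃ z ∈ Set.Icc a₀ a₁ ×ˢ Set.Icc b₀ b₁, f z = 0 ∧ g z = 0 := by
  have hex : ∀ y : Set.Icc b₀ b₁, ∃ x : Set.Icc a₀ a₁, f (x, y) = 0 := by
    intro y
    obtain ⟨x, hx, h⟩ := intermediate_value_Icc' ha
      (f := fun x => f (x, (y : ℝ))) (by fun_prop) ⟨hf₁ y y.2, hf₀ y y.2⟩
    exact ⟨⟨x, hx⟩, h⟩
  choose X hX using hex
  have hgraph : IsClosed {p : Set.Icc b₀ b₁ × Set.Icc a₀ a₁ | p.2 = X p.1} := by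
    have : {p : Set.Icc b₀ b₁ × Set.Icc a₀ a₁ | p.2 = X p.1} =
        {p | f ((p.2 : ℝ), (p.1 : ℝ)) = 0} := by
      ext p
      constructor
      · intro h
        have h' : p.2 = X p.1 := h
        simpa [h'] using hX p.1
      · intro h
        exact Subtype.ext ((hanti p.1).injective (h.trans (hX p.1).symm))
    rw [this]
    exact isClosed_eq (by fun_prop) continuous_const
  -- The zero set of `f` is the graph of `X`; a closed graph with compact target makes `X`
  -- continuous.
  have hXc : Continuous X := by
    rw [continuous_iff_isClosed]
    intro K hK
    have : X ⁻¹' K = Prod.fst '' ({p : Set.Icc b₀ b₁ × Set.Icc a₀ a₁ | p.2 = X p.1} ∩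
        Prod.snd ⁻¹' K) := by
      ext y
      constructor
      · exact fun h => ⟨(y, X y), ⟨rfl, h⟩, rfl⟩
      · rintro ⟨p, ⟨h₁, h₂⟩, rfl⟩
        have h₁' : p.2 = X p.1 := h₁
        have h₂' : p.2 ∈ K := h₂
        rwa [h₁'] at h₂'
    rw [this]
    exact isClosedMap_fst_of_compactSpace _ (hgraph.inter (hK.preimage continuous_snd))
  have : PreconnectedSpace (Set.Icc b₀ b₁) := Subtype.preconnectedSpace isPreconnected_Icc
  have hcont : Continuous fun y : Set.Icc b₀ b₁ => g ((X y : ℝ), (y : ℝ)) := by fun_prop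
  obtain ⟨y, hy⟩ := mem_range_of_exists_le_of_exists_ge hcont (c := 0)
    ⟨⟨b₁, hb, le_rfl⟩, hg₁ _ (X _).2⟩ ⟨⟨b₀, le_rfl, hb⟩, hg₀ _ (X _).2⟩
  exact ⟨_, ⟨(X y).2, y.2⟩, hX y, hy⟩

/-! ### The circle map and its rotation number -/

theorem liftF_add_two (c : ℝ × ℝ) (u : ℝ) : liftF c (u + 2) = liftF c u + 2 := by
  have h : sideLetter (u + 2) = sideLetter u := by
    have : ⌊u + 2⌋ = ⌊u⌋ + 2 := by exact_mod_cast Int.floor_add_intCast u 2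
    simp [sideLetter, this]
  rw [liftF, h, liftF, show u + 2 = u + 1 + 1 by ring, step_add_one, step_add_one]
  ring

theorem liftF_mem_Ico (c : ℝ × ℝ) (u : ℝ) :
    liftF c u ∈ Set.Ico (⌊u⌋ + 1 / 2 : ℝ) (⌊u⌋ + 3 / 2) := by
  have h₀ := (step_strictMono ((sideLetter u).value c)).monotone (Int.floor_le u)
  have h₁ := step_strictMono ((sideLetter u).value c) (Int.lt_floor_add_one u)
  rw [step_add_one] at h₁
  rw [step_int] at h₀ h₁
  exact ⟨h₀, by rw [liftF]; linarith⟩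

theorem liftF_monotone (c : ℝ × ℝ) : Monotone (liftF c) := by
  intro u v h
  rcases (Int.floor_mono h).eq_or_lt with hf | hf
  · have : sideLetter u = sideLetter v := by simp [sideLetter, hf]
    rw [liftF, liftF, this]
    exact (step_strictMono _).monotone h
  · have hu := (liftF_mem_Ico c u).2
    have hv := (liftF_mem_Ico c v).1
    have : (⌊u⌋ : ℝ) + 1 ≤ ⌊v⌋ := by exact_mod_cast hf
    linarith

/-- The lift of `F`, measured in full turns. -/
noncomputable def circleLift (c : ℝ × ℝ) : CircleDeg1Lift where
  toFun x := liftF c (2 * x) / 2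
  monotone' x y h := by
    have := liftF_monotone c (show 2 * x ≤ 2 * y by linarith)
    linarith
  map_add_one' x := by
    rw [show 2 * (x + 1) = 2 * x + 2 by ring, liftF_add_two]; ring

theorem circleLift_pow_apply (c : ℝ × ℝ) (n : ℕ) (x : ℝ) :
    (circleLift c ^ n) x = (liftF c)^[n] (2 * x) / 2 := by
  rw [CircleDeg1Lift.coe_pow]
  induction n generalizing x with
  | zero => simp
  | succ n ih =>
    rw [Function.iterate_succ_apply, ih, Function.iterate_succ_apply]
    change (liftF c)^[n] (2 * (liftF c (2 * x) / 2)) / 2 = _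
    rw [mul_div_cancel₀ _ (two_ne_zero)]

theorem sideLetter_eq_a_iff (u : ℝ) : sideLetter u = .a ↔ Even ⌊u⌋ := by
  by_cases h : Even ⌊u⌋ <;> simp [sideLetter, h]

theorem sideLetter_eq_b_iff (u : ℝ) : sideLetter u = .b ↔ ¬ Even ⌊u⌋ := by
  by_cases h : Even ⌊u⌋ <;> simp [sideLetter, h]

/-- One step crosses at most one integer. A factor `ab` is a passage from an even to an odd
half-turn, and `(⌊u⌋ + 1) / 2` increases by one exactly then. -/
theorem abCount_smul_dir (c : ℝ × ℝ) {r : ℝ} (hr : 0 < r) (u : ℝ) (n : ℕ) :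
    (abCount c (r • dir u) (n + 1) : ℤ) =
      (⌊(liftF c)^[n] u⌋ + 1) / 2 - (⌊u⌋ + 1) / 2 := by
  induction n with
  | zero => simp [abCount]
  | succ n ih =>
    -- Lengthening the prefix by one completes only the factor starting at `n`.
    have e : abCount c (r • dir u) (n + 1 + 1) = abCount c (r • dir u) (n + 1) +
        if code c (r • dir u) n = .a ∧ code c (r • dir u) (n + 1) = .b then 1 else 0 := by
      unfold abCount
      rw [Finset.range_add_one, Finset.filter_insert, if_neg (by simp),
        Finset.card_filter, Finset.card_filter, Finset.sum_range_succ,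
        Finset.sum_range_succ (n := n)]
      simp only [lt_irrefl, false_and, if_false, add_zero, lt_add_iff_pos_right, zero_lt_one,
        true_and]
      congr 1
      refine Finset.sum_congr rfl fun t ht => ?_
      rw [Finset.mem_range] at ht
      simp [ht, ht.le]
    rw [e, Nat.cast_add, ih, code_smul_dir c hr, code_smul_dir c hr,
      Function.iterate_succ_apply']
    generalize (liftF c)^[n] u = v
    have hv := liftF_mem_Ico c v
    have h₀ : ⌊v⌋ ≤ ⌊liftF c v⌋ := Int.le_floor.2 (by linarith [hv.1])
    have h₁ : ⌊liftF c v⌋ < ⌊v⌋ + 2 := Int.floor_lt.2 (by push_cast; linarith [hv.2])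
    simp only [sideLetter_eq_a_iff, sideLetter_eq_b_iff, Int.even_iff]
    split_ifs with h <;> push_cast <;> omega

theorem exists_eq_smul_dir {z : ℝ × ℝ} (hz : z ≠ 0) :
    ∃ r u : ℝ, 0 < r ∧ z = r • dir u := by
  set y : ℂ := ⟨-z.2, z.1⟩ with hy
  have hy0 : y ≠ 0 := by
    intro h
    have h₁ := congrArg Complex.re h
    have h₂ := congrArg Complex.im h
    simp only [hy, Complex.zero_re, Complex.zero_im] at h₁ h₂
    exact hz (Prod.ext h₂ (by simpa using h₁))
  refine ⟨‖y‖, y.arg / Real.pi, norm_pos_iff.2 hy0, ?_⟩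
  have e : Real.pi * (y.arg / Real.pi) = y.arg := mul_div_cancel₀ _ Real.pi_ne_zero
  apply Prod.ext
  · simp only [dir, e, Prod.smul_mk, smul_eq_mul, Complex.norm_mul_sin_arg]
    rfl
  · simp only [dir, e, Prod.smul_mk, smul_eq_mul, mul_neg, Complex.norm_mul_cos_arg]
    exact (neg_neg _).symm

/-- The count of `ab` differs from the displacement in full turns by at most `1`. The limit
therefore exists at every parameter, independently of the initial vector. -/
theorem hasRotationNumber_translationNumber (c : ℝ × ℝ) :
    HasRotationNumber c (circleLift c).translationNumber := by
  intro z hz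
  obtain ⟨r, u, hr, rfl⟩ := exists_eq_smul_dir hz
  rw [← tendsto_add_atTop_iff_nat 1]
  have h := (circleLift c).tendsto_translationNumber (u / 2)
  -- A prefix of length `n + 1` has only `n` transitions, whence this correction factor.
  have hn : Tendsto (fun n : ℕ => (n : ℝ) / (n + 1)) atTop (𝓝 1) :=
    tendsto_natCast_div_add_atTop 1
  have h₂ := h.mul hn
  rw [mul_one] at h₂
  have hinv : Tendsto (fun n : ℕ => 2 / ((n : ℝ) + 1)) atTop (𝓝 0) :=
    tendsto_const_nhds.div_atTop (tendsto_natCast_atTop_atTop.atTop_add tendsto_const_nhds)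
  refine h₂.congr_dist (squeeze_zero (fun _ => dist_nonneg) (fun n => ?_) hinv)
  have hpos : (0 : ℝ) < n + 1 := by positivity
  rw [circleLift_pow_apply, mul_div_cancel₀ u two_ne_zero]
  have hcount := abCount_smul_dir c hr u n
  have hcount' : (abCount c (r • dir u) (n + 1) : ℝ) =
      (((⌊(liftF c)^[n] u⌋ + 1) / 2 : ℤ) : ℝ) - (((⌊u⌋ + 1) / 2 : ℤ) : ℝ) := by
    exact_mod_cast hcount
  have bound : ∀ v : ℝ, v / 2 - 1 / 2 < (((⌊v⌋ + 1) / 2 : ℤ) : ℝ) ∧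
      (((⌊v⌋ + 1) / 2 : ℤ) : ℝ) ≤ v / 2 + 1 / 2 := by
    intro v
    have h₁ : 2 * ((⌊v⌋ + 1) / 2) ≤ ⌊v⌋ + 1 := by omega
    have h₂ : ⌊v⌋ ≤ 2 * ((⌊v⌋ + 1) / 2) := by omega
    have h₁' : 2 * (((⌊v⌋ + 1) / 2 : ℤ) : ℝ) ≤ ⌊v⌋ + 1 := by exact_mod_cast h₁
    have h₂' : (⌊v⌋ : ℝ) ≤ 2 * (((⌊v⌋ + 1) / 2 : ℤ) : ℝ) := by exact_mod_cast h₂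
    constructor <;> linarith [Int.floor_le v, Int.lt_floor_add_one v]
  have b₁ := bound u
  have b₂ := bound ((liftF c)^[n] u)
  push_cast
  rw [Real.dist_eq, hcount']
  have e : ((liftF c)^[n] u / 2 - u / 2) / n * (n / ((n : ℝ) + 1)) =
      ((liftF c)^[n] u / 2 - u / 2) / ((n : ℝ) + 1) := by
    rcases n.eq_zero_or_pos with rfl | hn
    · simp
    · have : (n : ℝ) ≠ 0 := by positivity
      field_simp
  rw [e, ← sub_div, abs_div, abs_of_pos hpos]
  refine div_le_div_of_nonneg_right ?_ hpos.le
  rw [abs_le]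
  constructor <;> linarith

theorem hasRotationNumber_of_iterate_eq {c : ℝ × ℝ} {N k : ℕ} (hN : 0 < N)
    (h : (liftF c)^[N] 0 = 2 * k) : HasRotationNumber c (k / N) := by
  have := (circleLift c).translationNumber_of_map_pow_eq_add_int (x := 0) (n := N) (m := k)
    (by rw [circleLift_pow_apply, mul_zero, h]; push_cast; ring) hN
  have h₂ := hasRotationNumber_translationNumber c
  rw [this] at h₂
  simpa using h₂

/-- At a point legal for a positive and a negative word of odd rank, the two words close up to
a period of the map. -/
theorem hasRotationNumber_of_isLegal {c : ℝ × ℝ} {w w' : List Letter} {n m : ℕ}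
    (h : IsLegal (.a :: w) c) (h' : IsLegal (.b :: w') c)
    (hn : turns .a w = 2 * n) (hm : turns .b w' = 2 * m) :
    HasRotationNumber c
      (((n + m + 1 : ℕ) : ℝ) / (((.a :: w).length + (.b :: w').length : ℕ) : ℝ)) := by
  refine hasRotationNumber_of_iterate_eq (by simp) ?_
  have e := h.stepWord_eq
  have e' := h'.stepWord_eq
  have hc := ((isLegal_iff _ _).1 h).1.stepWord_eq
  have hc' := ((isLegal_iff _ _).1 h').1.stepWord_eq
  simp only [startAngle] at hc hc'
  -- The first word ends at `2n + 1`, which is the start of the second word shifted by `n` full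
  -- turns.
  have heven : (liftF c)^[(Letter.b :: w').length] (1 + 2 * n) =
      (liftF c)^[(Letter.b :: w').length] 1 + 2 * n := by
    have key : Function.Commute (liftF c) (fun v => v + 2) := fun v => liftF_add_two c v
    have := ((key.iterate_iterate (Letter.b :: w').length n) 1)
    have hadd : ∀ x : ℝ, (fun v : ℝ => v + 2)^[n] x = x + 2 * n := fun x => by
      rw [add_right_iterate]; simp [mul_comm]
    rwa [hadd, hadd] at this
  rw [add_comm (Letter.a :: w).length, Function.iterate_add_apply, ← hc, e, hn]
  push_cast
  rw [add_comm (2 * (n : ℝ)) 1, heven, ← hc']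
  have := stepWord_add_one c (.b :: w') 0
  rw [zero_add] at this
  rw [this, e', hm]
  push_cast
  ring

/-! ### Assembly -/

theorem exists_minusWord_eq (l l' : Letter) {p : ℕ} (hp : 2 ≤ p) (q n : ℕ) :
    ∃ w, minusWord l l' p q n = l :: l :: w := by
  obtain ⟨p, rfl⟩ : ∃ i, p = i + 2 := ⟨p - 2, by omega⟩
  cases n with
  | zero => exact ⟨_, by simp only [minusWord, wordPow, List.replicate_succ]; rfl⟩
  | succ n => exact ⟨_, by simp only [minusWord, wordPow_succ, List.replicate_succ]; rfl⟩

theorem exists_plusWord_eq (l l' : Letter) {p : ℕ} (hp : 2 ≤ p) (q n : ℕ) :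
    ∃ w, plusWord l l' p q n = l :: l :: w := by
  obtain ⟨p, rfl⟩ : ∃ i, p = i + 1 := ⟨p - 1, by omega⟩
  exact ⟨_, by simp only [plusWord, List.replicate_succ]; rfl⟩

theorem isLegal_of_compat {l : Letter} {w : List Letter} {c : ℝ × ℝ} {n : ℕ}
    (h : stepWord c (l :: w) 0 = 2 * n + 1) (hc : Compat (sgn l • sgn) c (l :: w) 0) :
    IsLegal (l :: w) c := by
  rw [isLegal_cons_iff, h]
  have := sin_pi_mul_add n 1
  push_cast at this
  exact ⟨hc, by rw [this]; simp⟩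

theorem zeta_le_zeta_succ {j : ℕ} (hj : 2 ≤ j) : zeta j ≤ zeta (j + 1) := by
  have hj' : (2 : ℝ) ≤ j := by exact_mod_cast hj
  have := Real.pi_pos
  unfold zeta
  push_cast
  have h₁ : Real.pi / (j + 1) ≤ Real.pi / j :=
    div_le_div_of_nonneg_left Real.pi_pos.le (by linarith) (by linarith)
  have h₂ : Real.pi / j ≤ Real.pi := div_le_self Real.pi_pos.le (by linarith)
  have := Real.cos_le_cos_of_nonneg_of_le_pi (by positivity) h₂ h₁
  linarith

/-- The argument common to both families: the words enter only through their turns, palindromy and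
length, legality from the angle equation, and the signs on the sides. -/
theorem meetWithRotationNumber {κ ℓ n m : ℕ} (hκ : 2 ≤ κ) (hℓ : 2 ≤ ℓ)
    {w w' v v' : List Letter} {θ : ℝ} (hw : w = .a :: .a :: v) (hw' : w' = .b :: .b :: v')
    (hturns : turns .a w = 2 * n) (hturns' : turns .b w' = 2 * m)
    (hrev : (w ++ [Letter.a]).reverse = w ++ [Letter.a]) (hrev' : (w' ++ [Letter.b]).reverse = w' ++ [Letter.b])
    (hθ : θ = ((n + m + 1 : ℕ) : ℝ) / ((w.length + w'.length : ℕ) : ℝ))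
    (hcompat : ∀ c ∈ rotDomain κ ℓ, stepWord c w 0 = 2 * n + 1 →
      Compat (sgn .a • sgn) c w 0)
    (hcompat' : ∀ c ∈ rotDomain κ ℓ, stepWord c w' 0 = 2 * m + 1 →
      Compat (sgn .b • sgn) c w' 0)
    (h₀ : ∀ c ∈ rotDomain κ ℓ, c.1 = zeta κ → 2 * n + 1 ≤ stepWord c w 0)
    (h₁ : ∀ c ∈ rotDomain κ ℓ, c.1 = zeta (κ + 1) → stepWord c w 0 ≤ 2 * n + 1)
    (h₀' : ∀ c ∈ rotDomain κ ℓ, c.2 = zeta ℓ → 2 * m + 1 ≤ stepWord c w' 0)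
    (h₁' : ∀ c ∈ rotDomain κ ℓ, c.2 = zeta (ℓ + 1) → stepWord c w' 0 ≤ 2 * m + 1) :
    MeetWithRotationNumber (rotDomain κ ℓ) w w' θ := by
  have iκ := zeta_le_zeta_succ hκ
  have iℓ := zeta_le_zeta_succ hℓ
  have hlen : 2 ≤ w.length := by simp [hw]
  have hlen' : 2 ≤ w'.length := by simp [hw']
  have hlegal : ∀ c ∈ rotDomain κ ℓ, stepWord c w 0 = 2 * n + 1 → IsLegal w c := by
    intro c hc h
    have := hcompat c hc h
    subst hw
    exact isLegal_of_compat h this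
  have hlegal' : ∀ c ∈ rotDomain κ ℓ, stepWord c w' 0 = 2 * m + 1 → IsLegal w' c := by
    intro c hc h
    have := hcompat' c hc h
    subst hw'
    exact isLegal_of_compat h this
  have hrot : ∀ c, IsLegal w c → IsLegal w' c → HasRotationNumber c θ := by
    subst hw hw' hθ
    exact fun c h h' => hasRotationNumber_of_isLegal h h' (by simpa [turns] using hturns)
      (by simpa [turns] using hturns')
  constructor
  · obtain ⟨c, hc, hf, hg⟩ := exists_common_zero
      (f := fun c => stepWord c w 0 - (2 * n + 1)) (g := fun c => stepWord c w' 0 - (2 * m + 1))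
      ((continuous_stepWord w 0).sub continuous_const)
      ((continuous_stepWord w' 0).sub continuous_const) iκ iℓ
      (fun y s t hst => by
        have := stepWord_lt_stepWord (c := (s, y)) (d := (t, y)) (l := .a)
          (by rintro (_ | _) <;> simp [Letter.value, hst.le]) hst v
        rw [← hw] at this
        exact sub_lt_sub_right this _)
      (fun y hy => sub_nonneg.2 (h₀ _ ⟨⟨le_rfl, iκ⟩, hy⟩ rfl))
      (fun y hy => sub_nonpos.2 (h₁ _ ⟨⟨iκ, le_rfl⟩, hy⟩ rfl))
      (fun x hx => sub_nonneg.2 (h₀' _ ⟨hx, ⟨le_rfl, iℓ⟩⟩ rfl))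
      (fun x hx => sub_nonpos.2 (h₁' _ ⟨hx, ⟨iℓ, le_rfl⟩⟩ rfl))
    rw [sub_eq_zero] at hf hg
    exact ⟨c, ⟨⟨c, hlegal c hc hf, mem_connectedComponentIn
      (C_eq_zero_of_stepWord_eq hrev hlen hf)⟩, ⟨c, hlegal' c hc hg, mem_connectedComponentIn
      (C_eq_zero_of_stepWord_eq hrev' hlen' hg)⟩⟩, hc⟩
  -- In the domain, branch membership fixes both angles and thereby yields legality; outside it,
  -- legality is assumed.
  · rintro c ⟨hc, hc'⟩ (hD | ⟨hl, hl'⟩)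
    · refine hrot c (hlegal c hD ?_) (hlegal' c hD ?_)
      · subst hw
        rw [stepWord_eq_of_mem_legalBranch hrev hlen hc]
        simp only [turns, if_true, zero_add] at hturns ⊢
        rw [hturns]; push_cast; ring
      · subst hw'
        rw [stepWord_eq_of_mem_legalBranch hrev' hlen' hc']
        simp only [turns, if_true, zero_add] at hturns' ⊢
        rw [hturns']; push_cast; ring
    · exact hrot c hl hl'

end CriticalCurves

theorem mainTheorem12 (κ ℓ n m : ℕ) (hκ : 2 ≤ κ) (hℓ : 2 ≤ ℓ) :
    MeetWithRotationNumber (rotDomain κ ℓ)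
        (wordPow (aPow (κ + 1) ++ bPow ℓ) n ++ aPow κ)
        (wordPow (bPow (ℓ + 1) ++ aPow κ) m ++ bPow ℓ)
        (thetaMinus (κ + ℓ + 1) (n + m + 1)) ∧
      MeetWithRotationNumber (rotDomain κ ℓ)
        (aPow (κ + 1) ++ wordPow (bPow (ℓ + 1) ++ aPow κ) n)
        (bPow (ℓ + 1) ++ wordPow (aPow (κ + 1) ++ bPow ℓ) m)
        (thetaPlus (κ + ℓ + 1) (n + m + 1)) := by
  have hab : Letter.a ≠ Letter.b := by decide
  have εaa : (sgn .a • sgn) .a = 1 := by simp [sgn]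
  have εab : (sgn .a • sgn) .b = -1 := by simp [sgn]
  have εbb : (sgn .b • sgn) .b = 1 := by simp [sgn]
  have εba : (sgn .b • sgn) .a = -1 := by simp [sgn]
  have A : ∀ c ∈ rotDomain κ ℓ, (step (Letter.a.value c))^[κ] 0 ≤ 1 ∧
      1 ≤ (step (Letter.a.value c))^[κ + 1] 0 := fun c hc =>
    ⟨iterate_step_le_one hκ hc.1.1, one_le_iterate_step (by omega) hc.1.2⟩
  have B : ∀ c ∈ rotDomain κ ℓ, (step (Letter.b.value c))^[ℓ] 0 ≤ 1 ∧
      1 ≤ (step (Letter.b.value c))^[ℓ + 1] 0 := fun c hc =>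
    ⟨iterate_step_le_one hℓ hc.2.1, one_le_iterate_step (by omega) hc.2.2⟩
  have eA : ∀ {c : ℝ × ℝ} {j : ℕ}, 2 ≤ j → c.1 = zeta j →
      (step (Letter.a.value c))^[j] 0 = 1 := fun hj hs => by
    rw [Letter.value, hs, iterate_step_zeta hj]
  have eB : ∀ {c : ℝ × ℝ} {j : ℕ}, 2 ≤ j → c.2 = zeta j →
      (step (Letter.b.value c))^[j] 0 = 1 := fun hj hs => by
    rw [Letter.value, hs, iterate_step_zeta hj]
  constructor
  · obtain ⟨v, hv⟩ := exists_minusWord_eq .a .b hκ ℓ n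
    obtain ⟨v', hv'⟩ := exists_minusWord_eq .b .a hℓ κ m
    refine meetWithRotationNumber (n := n) (m := m) hκ hℓ hv hv'
      (turns_minusWord hab (by omega) (by omega) n)
      (turns_minusWord hab.symm (by omega) (by omega) m)
      (reverse_minusWord _ _ _ _ _) (reverse_minusWord _ _ _ _ _) ?_
      (fun c hc => compat_minusWord εaa εab (by omega) (A c hc).1 (A c hc).2 (B c hc).1)
      (fun c hc => compat_minusWord εbb εba (by omega) (B c hc).1 (B c hc).2 (A c hc).1)
      (fun c hc h => le_stepWord_minusWord (eA hκ h) (B c hc).2 n)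
      (fun c hc h => stepWord_minusWord_le (A c hc).1 (eA (by omega) h) (B c hc).1 n)
      (fun c hc h => le_stepWord_minusWord (eB hℓ h) (A c hc).2 m)
      (fun c hc h => stepWord_minusWord_le (B c hc).1 (eB (by omega) h) (A c hc).1 m)
    -- The lengths add up to `(n + m + 1)(κ + ℓ + 1) - 1`; for the second pair of words the last
    -- sign is plus.
    change _ = _ / (((minusWord .a .b κ ℓ n).length + (minusWord .b .a ℓ κ m).length : ℕ) : ℝ)
    rw [length_minusWord, length_minusWord, thetaMinus]
    congr 1
    push_cast
    ring
  · obtain ⟨v, hv⟩ := exists_plusWord_eq .a .b hκ ℓ n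
    obtain ⟨v', hv'⟩ := exists_plusWord_eq .b .a hℓ κ m
    refine meetWithRotationNumber (n := n) (m := m) hκ hℓ hv hv'
      (turns_plusWord hab (by omega) ℓ n) (turns_plusWord hab.symm (by omega) κ m)
      (reverse_plusWord _ _ _ _ _) (reverse_plusWord _ _ _ _ _) ?_
      (fun c hc => compat_plusWord εaa εab (by omega) (A c hc).1 (A c hc).2)
      (fun c hc => compat_plusWord εbb εba (by omega) (B c hc).1 (B c hc).2)
      (fun c hc h => le_stepWord_plusWord (eA hκ h) (B c hc).2 n)
      (fun c hc h => stepWord_plusWord_le (eA (by omega) h) (B c hc).1 n)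
      (fun c hc h => le_stepWord_plusWord (eB hℓ h) (A c hc).2 m)
      (fun c hc h => stepWord_plusWord_le (eB (by omega) h) (A c hc).1 m)
    change _ = _ / (((plusWord .a .b κ ℓ n).length + (plusWord .b .a ℓ κ m).length : ℕ) : ℝ)
    rw [length_plusWord, length_plusWord, thetaPlus]
    congr 1
    push_cast
    ring
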